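/- Let $D\subset\mathbb R^d$ be a bounded open set (in particular, a bounded domain), let $T>0$, $\mathrm{Re}>0$, $\mathrm{We}>0$ and $\varepsilon\in(0,1)$. Let $u$ (velocity, with values in $\mathbb R^d$), $p$ (pressure, real-valued) and $\tau$ (stress, with values in the real $d\times d$ matrices) be a regular solution on $[0,T)$ of the Oldroyd-B system $$\mathrm{Re}\,(\partial_t u+u\cdot\nabla u)=(1-\varepsilon)\Delta u-\nabla p+\operatorname{div}\tau,\qquad \operatorname{div}u=0,$$ $$\partial_t\tau+u\cdot\nabla\tau=\nabla u\,\tau+\tau(\nabla u)^T-\tfrac1{\mathrm{We}}\tau+\tfrac{\varepsilon}{\mathrm{We}}\big(\nabla u+(\nabla u)^T\big)$$ in $(0,T)\times D$, with $u=0$ on $[0,T)\times\partial D$; here $(\nabla u)_{ij}=\partial_{x_j}u_i$ and $(\operatorname{div}\tau)_i=\sum_j\partial_{x_j}\tau_{ij}$. Regular means: $u$ and $\tau$ are continuous on $[0,T)\times\overline D$ and $\nabla u$ extends continuously to $[0,T)\times\overline D$; moreover $\partial_t u,\nabla u,\nabla^2u,p,\nabla p,\partial_t\tau,\nabla\tau$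 exist classically in $(0,T)\times D$ and extend continuously to $(0,T)\times\overline D$. Put $A=\frac{\mathrm{We}}{\varepsilon}\tau+I$ and assume that $A(0,x)$ is symmetric positive definite for every $x\in\overline D$. Define, with $|\nabla u|^2=\sum_{i,j}(\partial_{x_j}u_i)^2$, $$F(t)=\frac{\mathrm{Re}}2\int_D|u|^2+\frac{\varepsilon}{2\mathrm{We}}\int_D(-\ln\det A-d+\operatorname{tr}A),$$ $$\Delta_F(t)=(1-\varepsilon)\int_D|\nabla u|^2+\frac{\varepsilon}{2\mathrm{We}^2}\int_D\operatorname{tr}\big((I-A^{-1})^2A\big).$$ Then: 1. For all $t\in[0,T)$ and $x\in\overline D$, $A(t,x)$ is symmetric positive definite and $-\ln\det A-d+\operatorname{tr}A\ge0$. 2. The integrals over $D$ in $F(t)$ (for $t\in[0,T)$) and in $\Delta_F(t)$ (for $t\in(0,T)$) converge absolutely. 3. $F$ is differentiable on $(0,T)$ and continuous on $[0,T)$, and for every $t\in(0,T)$ $$\frac{d}{dt}\left(\frac{\mathrm{Re}}2\int_D|u|^2+\frac{\varepsilon}{2\mathrm{We}}\int_D(-\ln\det A-d+\operatorname{tr}A)\right)+(1-\varepsilon)\int_D|\nabla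 u|^2+\frac{\varepsilon}{2\mathrm{We}^2}\int_D\operatorname{tr}\big((I-A^{-1})^2A\big)=0;$$ moreover, for every $t\in[0,T)$, $\Delta_F$ is integrable on $[0,t]$ and $F(t)+\int_0^t\Delta_F(s)\,ds=F(0)$. 4. Consequently, with no further assumption on $\tau(0)$, the following a priori bounds hold for all $t\in[0,T)$: $$\frac{\mathrm{Re}}2\int_D|u(t)|^2\le F(0),\qquad (1-\varepsilon)\int_0^t\!\int_D|\nabla u|^2\le F(0),\qquad \int_D|\tau(t)|\le 4F(0)+\frac{\varepsilon d}{\mathrm{We}}|D|,$$ where $|\tau|=(\sum_{i,j}\tau_{ij}^2)^{1/2}$, $|D|$ is the Lebesgue measure of $D$, $t\mapsto\int_D|\nabla u|^2$ is integrable on $[0,t]$, and $\tau(t)$ is integrable on $D$. -/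

import Mathlib

open Set MeasureTheory

noncomputable section

namespace OldroydB

/-- Points of `ℝ^d`, with the Euclidean norm and Lebesgue measure. -/
abbrev Space (d : ℕ) := EuclideanSpace ℝ (Fin d)

/-- Real `d × d` matrices. -/
abbrev Mat (d : ℕ) := Matrix (Fin d) (Fin d) ℝ

variable {d : ℕ}

/-! ### Partial derivatives of time-dependent scalar fields -/

/-- The time derivative `∂f/∂t`. -/
def dt (f : ℝ → Space d → ℝ) (t : ℝ) (x : Space d) : ℝ :=
  deriv (fun s => f s x) t

/-- The space derivative `∂f/∂x_j`. -/
def dx (j : Fin d) (f : ℝ → Space d → ℝ) (t : ℝ) (x : Space d) : ℝ :=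
  fderiv ℝ (f t) x (EuclideanSpace.single j 1)

/-- The `i`-th component of a vector field. -/
def comp (u : ℝ → Space d → Space d) (i : Fin d) : ℝ → Space d → ℝ :=
  fun t x => u t x i

/-- The `(i, j)` entry of a matrix field. -/
def entry (τ : ℝ → Space d → Mat d) (i j : Fin d) : ℝ → Space d → ℝ :=
  fun t x => τ t x i j

/-- The velocity gradient, `(∇u)_{ij} = ∂u_i/∂x_j`. -/
def grad (u : ℝ → Space d → Space d) (t : ℝ) (x : Space d) : Mat d :=
  Matrix.of fun i j => dx j (comp u i) t x

/-- The transport derivative `∂f/∂t + u·∇f` of a scalar field. -/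
def transport (u : ℝ → Space d → Space d) (f : ℝ → Space d → ℝ) (t : ℝ) (x : Space d) : ℝ :=
  dt f t x + ∑ j, u t x j * dx j f t x

/-! ### Regular fields -/

/-- The restriction of `f` to `Q` has a continuous extension to `Q'`. -/
def ExtendsTo (Q Q' : Set (ℝ × Space d)) (f : ℝ → Space d → ℝ) : Prop :=
  ∃ g : ℝ × Space d → ℝ, ContinuousOn g Q' ∧ ∀ t x, (t, x) ∈ Q → g (t, x) = f t x

/-- On `(0, T) × D`, `f` is differentiable in time, and `∂f/∂t` extends continuously to
`(0, T) × closure D`. -/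
structure TimeC1 (T : ℝ) (D : Set (Space d)) (f : ℝ → Space d → ℝ) : Prop where
  diff : ∀ t ∈ Ioo 0 T, ∀ x ∈ D, DifferentiableAt ℝ (fun s => f s x) t
  ext : ExtendsTo (Ioo 0 T ×ˢ D) (Ioo 0 T ×ˢ closure D) (dt f)

/-- On `(0, T) × D`, `f` is differentiable in space, and `f` and its first space derivatives
extend continuously to `(0, T) × closure D`. -/
structure SpaceC1 (T : ℝ) (D : Set (Space d)) (f : ℝ → Space d → ℝ) : Prop where
  diff : ∀ t ∈ Ioo 0 T, ∀ x ∈ D, DifferentiableAt ℝ (f t) x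
  ext : ExtendsTo (Ioo 0 T ×ˢ D) (Ioo 0 T ×ˢ closure D) f
  ext_dx : ∀ j, ExtendsTo (Ioo 0 T ×ˢ D) (Ioo 0 T ×ˢ closure D) (dx j f)

/-- Regularity of a solution `(u, p, τ)` on `[0, T)`: for positive times `u` is `C¹` in time and
`C²` in space, `p` is `C¹` in space and `τ` is `C¹` in time and space, with all these derivatives
continuous up to the boundary of `D`; and `u`, `∇u`, `τ` are continuous up to the initial time. -/
structure IsRegular (T : ℝ) (D : Set (Space d)) (u : ℝ → Space d → Space d)
    (p : ℝ → Space d → ℝ) (τ : ℝ → Space d → Mat d) : Prop where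
  u_cont : ContinuousOn (fun z : ℝ × Space d => u z.1 z.2) (Ico 0 T ×ˢ closure D)
  grad_u_cont : ∀ i j, ExtendsTo (Ioo 0 T ×ˢ D) (Ico 0 T ×ˢ closure D) (dx j (comp u i))
  τ_cont : ContinuousOn (fun z : ℝ × Space d => τ z.1 z.2) (Ico 0 T ×ˢ closure D)
  u_time : ∀ i, TimeC1 T D (comp u i)
  u_space : ∀ i, SpaceC1 T D (comp u i)
  grad_u_space : ∀ i j, SpaceC1 T D (dx j (comp u i))
  p_space : SpaceC1 T D p
  τ_time : ∀ i j, TimeC1 T D (entry τ i j)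
  τ_space : ∀ i j, SpaceC1 T D (entry τ i j)

/-! ### The Oldroyd-B system -/

/-- `(u, p, τ)` solves the Oldroyd-B system in `(0, T) × D`, with `u = 0` on the boundary. -/
structure IsSolution (T : ℝ) (D : Set (Space d)) (Re We ε : ℝ) (u : ℝ → Space d → Space d)
    (p : ℝ → Space d → ℝ) (τ : ℝ → Space d → Mat d) : Prop where
  /-- `Re (∂u/∂t + u·∇u) = (1 - ε) Δu - ∇p + div τ` -/
  momentum : ∀ t ∈ Ioo 0 T, ∀ x ∈ D, ∀ i,
    Re * transport u (comp u i) t x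
      = (1 - ε) * ∑ j, dx j (dx j (comp u i)) t x - dx i p t x + ∑ j, dx j (entry τ i j) t x
  /-- `div u = 0` -/
  incompressible : ∀ t ∈ Ioo 0 T, ∀ x ∈ D, ∑ i, dx i (comp u i) t x = 0
  /-- `∂τ/∂t + u·∇τ = ∇u τ + τ (∇u)ᵀ - τ / We + (ε / We) (∇u + (∇u)ᵀ)` -/
  stress : ∀ t ∈ Ioo 0 T, ∀ x ∈ D,
    Matrix.of (fun i j => transport u (entry τ i j) t x)
      = grad u t x * τ t x + τ t x * (grad u t x).transpose - (1 / We) • τ t x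
        + (ε / We) • (grad u t x + (grad u t x).transpose)
  /-- no-slip boundary condition -/
  no_slip : ∀ t ∈ Ico 0 T, ∀ x ∈ frontier D, u t x = 0

/-! ### Conformation tensor, free energy and dissipation -/

/-- The conformation tensor `A = (We / ε) τ + I`. -/
def conformation (We ε : ℝ) (τ : ℝ → Space d → Mat d) (t : ℝ) (x : Space d) : Mat d :=
  (We / ε) • τ t x + 1

/-- `-ln det M - d + tr M`. -/
def entropyDensity (M : Mat d) : ℝ := -Real.log M.det - d + M.trace

/-- `tr ((I - M⁻¹)² M)`. -/
def relaxDensity (M : Mat d) : ℝ := ((1 - M⁻¹) ^ 2 * M).trace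

/-- `|M|² = M : M`. -/
def normSq (M : Mat d) : ℝ := ∑ i, ∑ j, M i j ^ 2

/-- `(Re / 2) ∫_D |u|² + (ε / (2 We)) ∫_D (-ln det A - d + tr A)` at time `t`. -/
def freeEnergy (D : Set (Space d)) (Re We ε : ℝ) (u : ℝ → Space d → Space d)
    (τ : ℝ → Space d → Mat d) (t : ℝ) : ℝ :=
  Re / 2 * (∫ x in D, ‖u t x‖ ^ 2)
    + ε / (2 * We) * (∫ x in D, entropyDensity (conformation We ε τ t x))

/-- `(1 - ε) ∫_D |∇u|² + (ε / (2 We²)) ∫_D tr ((I - A⁻¹)² A)` at time `t`. -/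
def dissipation (D : Set (Space d)) (We ε : ℝ) (u : ℝ → Space d → Space d)
    (τ : ℝ → Space d → Mat d) (t : ℝ) : ℝ :=
  (1 - ε) * (∫ x in D, normSq (grad u t x))
    + ε / (2 * We ^ 2) * (∫ x in D, relaxDensity (conformation We ε τ t x))

end OldroydB

end

/-! The estimate comes from testing the momentum equation with `u` and the equation for `A` with `I
- A⁻¹`, the gradient of the entropy `tr A - ln det A`. Because `u` is divergence free and vanishes
on the boundary, convection and pressure integrate to zero. The kinetic energy then loses `(1 - ε) ∫
|∇u|²` and the stress power `∫ ∇u : τ`. The law `∂A/∂t + u·∇A = ∇u A + A (∇u)ᵀ - (A - I) / We` makes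
the entropy gain `2 (We / ε) ∇u : τ` and lose `tr ((I - A⁻¹)² A) / We`. The weight `ε / (2 We)`
cancels the coupling exactly (`IsSolution.hasDerivAt_freeEnergy`).

This requires `A` to stay positive definite. The antisymmetric part of `τ` solves a homogeneous
linear transport equation, so it stays zero. While `A` is positive definite, `ln det A` decreases
along the flow at rate at most `d / We`, so `det A` stays away from zero. At a first time of failure
`A` would be semidefinite with a kernel, hence of zero determinant, a contradiction
(`IsSolution.conformation_posDef`).

No characteristics are used: minimum principles follow from integrating over `D` and Grönwall's
argument. `D` is an arbitrary bounded open set, so integration by parts rests on truncating the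
function that vanishes on the boundary (`setIntegral_fderiv_mul_eq_neg`). The stress bound reduces
to an inequality for each eigenvalue of `A` (`sqrt_normSq_sub_one_le`). -/

noncomputable section
namespace OldroydB
open Filter Topology Bornology

variable {d : ℕ}

/-- There is a `C¹` function vanishing near `0`, equal to the identity near infinity, bounded by the
identity and with bounded derivative. -/
theorem exists_truncation : ∃ (φ φ' : ℝ → ℝ) (C : ℝ), (∀ s, HasDerivAt φ (φ' s) s) ∧
    Continuous φ' ∧ (∀ s, |s| ≤ 1 → φ s = 0) ∧ (∀ s, 2 ≤ |s| → φ s = s ∧ φ' s = 1) ∧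
    (∀ s, |φ s| ≤ |s|) ∧ ∀ s, |φ' s| ≤ C := by
  -- The cutoff rises from 0 at `|s| = 1` to 1 at `|s| = √2 < 3/2`, so `φ` is the identity on a
  -- neighbourhood of `2 ≤ |s|`.
  let φ : ℝ → ℝ := fun s => s * Real.smoothTransition (s ^ 2 - 1)
  have hφ : ContDiff ℝ 1 φ := contDiff_id.mul
    ((Real.smoothTransition.contDiff (n := 1)).comp ((contDiff_id.pow 2).sub contDiff_const))
  have h0 : ∀ s, |s| ≤ 1 → φ s = 0 := fun s hs => by
    have : Real.smoothTransition (s ^ 2 - 1) = 0 :=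
      Real.smoothTransition.zero_of_nonpos (by have := (sq_le_one_iff_abs_le_one s).2 hs; linarith)
    simp [φ, this]
  have h1 : ∀ s, 3 / 2 < |s| → φ s = s := fun s hs => by
    have : Real.smoothTransition (s ^ 2 - 1) = 1 :=
      Real.smoothTransition.one_of_one_le (by rw [← sq_abs]; nlinarith)
    simp [φ, this]
  have hφ' : Continuous (deriv φ) := hφ.continuous_deriv le_rfl
  have h1' : ∀ s, 2 ≤ |s| → deriv φ s = 1 := fun s hs => by
    have : φ =ᶠ[𝓝 s] id := by
      filter_upwards [(isOpen_lt continuous_const continuous_abs).mem_nhds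
        (show 3 / 2 < |s| by linarith)] with y hy using h1 y hy
    rw [this.deriv_eq, deriv_id]
  obtain ⟨C, hC⟩ := (isCompact_Icc (a := (-2 : ℝ)) (b := 2)).exists_bound_of_continuousOn
    hφ'.continuousOn
  refine ⟨φ, deriv φ, max C 1, fun s => (hφ.differentiable one_ne_zero s).hasDerivAt, hφ', h0,
    fun s hs => ⟨h1 s (by linarith), h1' s hs⟩, fun s => ?_, fun s => ?_⟩
  · rw [abs_mul, abs_of_nonneg (Real.smoothTransition.nonneg _)]
    exact mul_le_of_le_one_right (abs_nonneg _) (Real.smoothTransition.le_one _)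
  · rcases le_total |s| 2 with h | h
    · exact (hC s (abs_le.1 h)).trans (le_max_left _ _)
    · rw [h1' s h, abs_one]; exact le_max_right _ _

/-! ### Integration by parts on an arbitrary bounded open set -/

section IntegrationByParts

variable {E : Type*} [NormedAddCommGroup E] [NormedSpace ℝ E] [MeasurableSpace E] [BorelSpace E]
  [FiniteDimensional ℝ E] (μ : Measure E) [μ.IsAddHaarMeasure] {D : Set E} {w g : E → ℝ} {v : E}

/-- A continuous bounded function on a bounded open set is integrable. -/
theorem integrableOn_of_continuousOn_of_bound {f : E → ℝ} {C : ℝ} (hD : IsOpen D)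
    (hDb : IsBounded D) (hf : ContinuousOn f D) (hC : ∀ x ∈ D, |f x| ≤ C) :
    IntegrableOn f D μ := by
  have : IsFiniteMeasure (μ.restrict D) := ⟨by simpa using hDb.measure_lt_top⟩
  refine Integrable.of_bound (hf.aestronglyMeasurable hD.measurableSet) C ?_
  filter_upwards [ae_restrict_mem hD.measurableSet] with x hx using hC x hx

/-- On the zero set of a function, its derivative in a given direction vanishes almost
everywhere. -/
theorem measure_zero_inter_fderiv_ne_zero (hD : IsOpen D) (hw : ∀ x ∈ D, DifferentiableAt ℝ w x)
    (hw' : ContinuousOn (fun x => fderiv ℝ w x v) D) :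
    μ {x | x ∈ D ∧ w x = 0 ∧ fderiv ℝ w x v ≠ 0} = 0 := by
  refine measure_null_of_locally_null _ fun x hx => ?_
  obtain ⟨hxD, -, hx'⟩ := hx
  have hopen : IsOpen (D ∩ (fun x => fderiv ℝ w x v) ⁻¹' {0}ᶜ) :=
    hw'.isOpen_inter_preimage hD isOpen_compl_singleton
  obtain ⟨r, hr, hball⟩ := Metric.isOpen_iff.1 hopen x ⟨hxD, hx'⟩
  let s : Set E := {y | y ∈ Metric.ball x r ∧ w y = 0}
  have hwc : ContinuousOn w (Metric.ball x r) := fun y hy =>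
    (hw y (hball hy).1).continuousAt.continuousWithinAt
  have hs : MeasurableSet s := by
    have h : IsOpen (Metric.ball x r ∩ w ⁻¹' {0}ᶜ) :=
      hwc.isOpen_inter_preimage Metric.isOpen_ball isOpen_compl_singleton
    have hsd : s = Metric.ball x r \ (Metric.ball x r ∩ w ⁻¹' {0}ᶜ) := by
      ext y
      simp only [s, mem_ofPred_eq, Set.mem_sdiff, mem_inter_iff, mem_preimage, mem_compl_iff,
        mem_singleton_iff]
      tauto
    rw [hsd]
    exact Metric.isOpen_ball.measurableSet.diff h.measurableSet
  -- Two zeros of `w` in the ball that differ by a multiple of `v` would, by Rolle, give a zero of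
  -- the derivative along `v` between them; the ball was chosen to exclude this.
  have key : ∀ y ∈ s, ∀ c : ℝ, c ≠ 0 → y + c • v ∉ s := by
    intro y hy c hc hyc
    have hseg : ∀ θ ∈ Icc (0 : ℝ) 1, y + (θ * c) • v ∈ Metric.ball x r := fun θ hθ => by
      have := (convex_ball x r).add_smul_sub_mem hy.1 hyc.1 hθ
      rwa [add_sub_cancel_left, smul_smul] at this
    have hder : ∀ θ ∈ Icc (0 : ℝ) 1, HasDerivAt (fun θ : ℝ => w (y + (θ * c) • v))
        (c * fderiv ℝ w (y + (θ * c) • v) v) θ := fun θ hθ => by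
      have h1 : HasDerivAt (fun θ : ℝ => y + (θ * c) • v) (c • v) θ := by
        simpa using (((hasDerivAt_id θ).mul_const c).smul_const v).const_add y
      have := (hw _ (hball (hseg θ hθ)).1).hasFDerivAt.comp_hasDerivAt θ h1
      simpa [Function.comp_def] using this
    obtain ⟨θ, hθ, h0⟩ := exists_hasDerivAt_eq_zero zero_lt_one
      (fun θ hθ => (hder θ hθ).continuousAt.continuousWithinAt)
      (by simp only [zero_mul, zero_smul, add_zero, one_mul]; rw [hy.2, hyc.2])
      (fun θ hθ => hder θ (Ioo_subset_Icc_self hθ))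
    exact (mul_ne_zero hc (hball (hseg θ (Ioo_subset_Icc_self hθ))).2) h0
  -- The translates of `s` by `v / (n + 1)` are pairwise disjoint and stay in a bounded region, so
  -- `s` is null.
  refine ⟨s, ?_, Measure.addHaar_eq_zero_of_disjoint_translates μ
    (fun n : ℕ => (1 / ((n : ℝ) + 1)) • v) ?_ ?_ hs⟩
  · filter_upwards [self_mem_nhdsWithin, mem_nhdsWithin_of_mem_nhds (Metric.ball_mem_nhds x hr)]
      with y hy hyb using ⟨hyb, hy.2.1⟩
  · exact Metric.isBounded_range_of_tendsto _
      ((tendsto_one_div_add_atTop_nhds_zero_nat (𝕜 := ℝ)).smul_const v)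
  · intro n m hnm
    refine Set.disjoint_left.2 fun z hzn hzm => ?_
    simp only [singleton_add, image_add_left, mem_preimage] at hzn hzm
    refine key _ hzn (1 / ((n : ℝ) + 1) - 1 / ((m : ℝ) + 1)) (fun h => hnm ?_) ?_
    · have h' : (n : ℝ) + 1 = m + 1 := by
        have := sub_eq_zero.1 h
        simpa using this
      exact_mod_cast add_right_cancel h'
    · convert hzm using 1
      rw [sub_smul]; abel

/-- Integration by parts on a bounded open set without any regularity of its boundary, for functions
one of which vanishes on the boundary. -/
theorem setIntegral_fderiv_mul_eq_neg (hD : IsOpen D) (hDb : IsBounded D)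
    (hwc : ContinuousOn w (closure D)) (hw0 : ∀ x ∈ frontier D, w x = 0)
    (hw : ∀ x ∈ D, DifferentiableAt ℝ w x) (hw' : ContinuousOn (fun x => fderiv ℝ w x v) D)
    (hwb : ∃ C, ∀ x ∈ D, |fderiv ℝ w x v| ≤ C)
    (hg : ∀ x ∈ D, DifferentiableAt ℝ g x) (hg' : ContinuousOn (fun x => fderiv ℝ g x v) D)
    (hgb : ∃ C, ∀ x ∈ D, |g x| ≤ C) (hgb' : ∃ C, ∀ x ∈ D, |fderiv ℝ g x v| ≤ C) :
    ∫ x in D, fderiv ℝ w x v * g x ∂μ = -∫ x in D, w x * fderiv ℝ g x v ∂μ := by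
  obtain ⟨φ, φ', C, hφ, hφ'c, hφ0, hφ1, hφle, hφ'le⟩ := exists_truncation
  obtain ⟨Cw, hCw⟩ := hDb.isCompact_closure.exists_bound_of_continuousOn hwc
  obtain ⟨Cw', hCw'⟩ := hwb
  obtain ⟨Cg, hCg⟩ := hgb
  obtain ⟨Cg', hCg'⟩ := hgb'
  have hDm := hD.measurableSet
  have : IsFiniteMeasure (μ.restrict D) := ⟨by simpa using hDb.measure_lt_top⟩
  have hgc : ContinuousOn g D := fun x hx => (hg x hx).continuousAt.continuousWithinAt
  have hφc : Continuous φ := continuous_iff_continuousAt.2 fun s => (hφ s).continuousAt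
  -- The truncated `w` vanishes where `|w| ≤ 1 / (n + 1)`, hence near the boundary. So `W n`
  -- extended by zero is differentiable on all of `E`, and `P n` is its derivative along `v`.
  let W : ℕ → E → ℝ := fun n x => φ ((n + 1) * w x) / (n + 1) * g x
  let P : ℕ → E → ℝ := fun n x =>
    φ' ((n + 1) * w x) * fderiv ℝ w x v * g x + φ ((n + 1) * w x) / (n + 1) * fderiv ℝ g x v
  have hn : ∀ n : ℕ, (0 : ℝ) < n + 1 := fun n => by positivity
  have hwD : ContinuousOn w D := hwc.mono subset_closure
  have hPc : ∀ n, ContinuousOn (P n) D := fun n =>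
    ((hφ'c.comp_continuousOn (continuousOn_const.mul hwD)).mul hw' |>.mul hgc).add
      (((hφc.comp_continuousOn (continuousOn_const.mul hwD)).div_const _).mul hg')
  have hPm : ∀ n, AEStronglyMeasurable (P n) (μ.restrict D) := fun n =>
    (hPc n).aestronglyMeasurable hDm
  have hφw : ∀ (n : ℕ), ∀ x ∈ D, |φ ((n + 1) * w x) / (n + 1)| ≤ Cw := fun n x hx => by
    rw [abs_div, abs_of_pos (hn n), div_le_iff₀ (hn n)]
    refine (hφle _).trans ?_
    rw [abs_mul, abs_of_pos (hn n), mul_comm]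
    exact mul_le_mul_of_nonneg_right (hCw x (subset_closure hx)) (hn n).le
  have hPb : ∀ n, ∀ x ∈ D, ‖P n x‖ ≤ C * Cw' * Cg + Cw * Cg' := fun n x hx => by
    have hC : 0 ≤ C := (abs_nonneg _).trans (hφ'le 0)
    have hCw0 : 0 ≤ Cw := (norm_nonneg _).trans (hCw x (subset_closure hx))
    have hCw'0 : 0 ≤ Cw' := (abs_nonneg _).trans (hCw' x hx)
    refine (norm_add_le _ _).trans (add_le_add ?_ ?_)
    · rw [Real.norm_eq_abs, abs_mul, abs_mul]
      gcongr
      exacts [hφ'le _, hCw' x hx, hCg x hx]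
    · rw [Real.norm_eq_abs, abs_mul]
      gcongr
      exacts [hφw n x hx, hCg' x hx]
  have hzero : ∀ n, ∫ x in D, P n x ∂μ = 0 := fun n => by
    have hW : ∀ x, DifferentiableAt ℝ (D.indicator (W n)) x ∧
        fderiv ℝ (D.indicator (W n)) x v = D.indicator (P n) x := by
      intro x
      by_cases hx : x ∈ D
      · have hev : D.indicator (W n) =ᶠ[𝓝 x] W n := by
          filter_upwards [hD.mem_nhds hx] with y hy using indicator_of_mem hy _
        have h1 := ((hφ ((n + 1) * w x)).comp_hasFDerivAt x
          ((hw x hx).hasFDerivAt.const_mul ((n : ℝ) + 1))).mul_const ((n : ℝ) + 1)⁻¹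
        have h2 := h1.mul (hg x hx).hasFDerivAt
        have h3 : HasFDerivAt (D.indicator (W n)) _ x :=
          HasFDerivAt.congr_of_eventuallyEq h2 hev
        refine ⟨h3.differentiableAt, ?_⟩
        rw [h3.fderiv, indicator_of_mem hx]
        have := (hn n).ne'
        simp [P]
        field_simp
        ring
      · have hev : D.indicator (W n) =ᶠ[𝓝 x] fun _ => 0 := by
          by_cases hxc : x ∈ closure D
          · have hx0 : w x = 0 := hw0 x ⟨hxc, by rwa [hD.interior_eq]⟩
            have h1 : ∀ᶠ y in 𝓝[closure D] x, |(n + 1) * w y| < 1 := by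
              have : ContinuousWithinAt (fun y => |((n : ℝ) + 1) * w y|) (closure D) x :=
                (continuousWithinAt_const.mul (hwc x hxc)).abs
              refine this.eventually_lt_const ?_
              simp [hx0]
            filter_upwards [eventually_nhdsWithin_iff.1 h1] with y hy
            by_cases hyD : y ∈ D
            · rw [indicator_of_mem hyD]
              simp [W, hφ0 _ (hy (subset_closure hyD)).le]
            · exact indicator_of_notMem hyD _
          · filter_upwards [isClosed_closure.isOpen_compl.mem_nhds hxc] with y hy
            exact indicator_of_notMem (fun h => hy (subset_closure h)) _
        have h3 : HasFDerivAt (D.indicator (W n)) (0 : E →L[ℝ] ℝ) x :=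
          (hasFDerivAt_const (0 : ℝ) x).congr_of_eventuallyEq hev
        refine ⟨h3.differentiableAt, ?_⟩
        rw [h3.fderiv, indicator_of_notMem hx]
        rfl
    have hWi : Integrable (D.indicator (W n)) μ := by
      rw [integrable_indicator_iff hDm]
      refine integrableOn_of_continuousOn_of_bound μ (C := Cw * Cg) hD hDb
        (((hφc.comp_continuousOn (continuousOn_const.mul hwD)).div_const _).mul hgc) fun x hx => ?_
      rw [abs_mul]
      exact mul_le_mul (hφw n x hx) (hCg x hx) (abs_nonneg _)
        ((norm_nonneg _).trans (hCw x (subset_closure hx)))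
    have hPi : Integrable (D.indicator (P n)) μ := by
      rw [integrable_indicator_iff hDm]
      exact integrableOn_of_continuousOn_of_bound μ hD hDb (hPc n) (hPb n)
    -- With one factor equal to 1, integration by parts on the whole space says that the integral of
    -- a derivative is zero.
    have h := integral_mul_fderiv_eq_neg_fderiv_mul_of_integrable (μ := μ) (𝕜 := ℝ)
      (f := fun _ : E => (1 : ℝ)) (g := D.indicator (W n)) (v := v) (by simp)
      (by simpa [fun x => (hW x).2] using hPi) (by simpa using hWi) (fun x _ => by fun_prop)
      (fun x _ => (hW x).1)
    simpa [fun x => (hW x).2, integral_indicator hDm] using h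
  have hlim : Tendsto (fun n => ∫ x in D, P n x ∂μ) atTop
      (𝓝 (∫ x in D, (fderiv ℝ w x v * g x + w x * fderiv ℝ g x v) ∂μ)) := by
    refine tendsto_integral_of_dominated_convergence (fun _ => C * Cw' * Cg + Cw * Cg') hPm
      (integrable_const _) (fun n => ?_) ?_
    · filter_upwards [ae_restrict_mem hDm] with x hx using hPb n x hx
    -- Where `w ≠ 0`, `P n` eventually equals its limit. Where `w = 0`, the limit is right only if
    -- the derivative of `w` vanishes too, which holds almost everywhere.
    · have hnull := measure_zero_inter_fderiv_ne_zero μ hD hw hw'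
      filter_upwards [ae_restrict_mem hDm, ae_restrict_of_ae (compl_mem_ae_iff.2 hnull)]
        with x hx hxn
      by_cases h0 : w x = 0
      · have h0' : fderiv ℝ w x v = 0 := by
          by_contra h
          exact hxn ⟨hx, h0, h⟩
        simp [P, h0, h0', hφ0]
      · refine tendsto_const_nhds.congr' ?_
        obtain ⟨N, hN⟩ := exists_nat_gt (2 / |w x|)
        filter_upwards [eventually_ge_atTop N] with n hnN
        have : 2 ≤ |(n + 1) * w x| := by
          rw [abs_mul, abs_of_pos (hn n)]
          rw [div_lt_iff₀ (abs_pos.2 h0)] at hN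
          have : (N : ℝ) ≤ n := by exact_mod_cast hnN
          nlinarith [abs_nonneg (w x)]
        have := hφ1 _ this
        simp only [P, this.1, this.2]
        have := (hn n).ne'
        field_simp
  have hsum : ∫ x in D, (fderiv ℝ w x v * g x + w x * fderiv ℝ g x v) ∂μ = 0 :=
    tendsto_nhds_unique hlim (by simp [hzero])
  rw [integral_add] at hsum
  · linarith
  · refine integrableOn_of_continuousOn_of_bound μ (C := Cw' * Cg) hD hDb (hw'.mul hgc)
      fun x hx => ?_
    rw [abs_mul]
    exact mul_le_mul (hCw' x hx) (hCg x hx) (abs_nonneg _) ((abs_nonneg _).trans (hCw' x hx))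
  · refine integrableOn_of_continuousOn_of_bound μ (C := Cw * Cg') hD hDb (hwD.mul hg')
      fun x hx => ?_
    rw [abs_mul]
    exact mul_le_mul (hCw x (subset_closure hx)) (hCg' x hx) (abs_nonneg _)
      ((norm_nonneg _).trans (hCw x (subset_closure hx)))

end IntegrationByParts

/-! ### Transport by a divergence-free flow -/

section Transport

variable {D : Set (Space d)} {T : ℝ} {u : ℝ → Space d → Space d}

/-! ### Continuous fields on a bounded open set -/

theorem ExtendsTo.mono {Q Q' R R' : Set (ℝ × Space d)} {f : ℝ → Space d → ℝ}
    (h : ExtendsTo Q Q' f) (hR : R ⊆ Q) (hR' : R' ⊆ Q') : ExtendsTo R R' f :=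
  let ⟨g, hg, hgf⟩ := h
  ⟨g, hg.mono hR', fun t x hx => hgf t x (hR hx)⟩

theorem ExtendsTo.continuousOn_slice {I : Set ℝ} {f : ℝ → Space d → ℝ}
    (h : ExtendsTo (I ×ˢ D) (I ×ˢ closure D) f) {t : ℝ} (ht : t ∈ I) : ContinuousOn (f t) D := by
  obtain ⟨g, hg, hgf⟩ := h
  have : ContinuousOn (fun x => g (t, x)) D :=
    hg.comp (by fun_prop) fun x hx => ⟨ht, subset_closure hx⟩
  exact this.congr fun x hx => (hgf t x ⟨ht, hx⟩).symm

theorem ExtendsTo.exists_bound (hDb : IsBounded D) {I J K : Set ℝ} {f : ℝ → Space d → ℝ}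
    (h : ExtendsTo (I ×ˢ D) (J ×ˢ closure D) f) (hK : IsCompact K) (hKJ : K ⊆ J) :
    ∃ C, ∀ t ∈ K, t ∈ I → ∀ x ∈ D, |f t x| ≤ C := by
  obtain ⟨g, hg, hgf⟩ := h
  obtain ⟨C, hC⟩ := (hK.prod hDb.isCompact_closure).exists_bound_of_continuousOn
    (hg.mono (prod_mono hKJ subset_rfl))
  exact ⟨C, fun t ht htI x hx => hgf t x ⟨htI, hx⟩ ▸ hC (t, x) ⟨ht, subset_closure hx⟩⟩

theorem ExtendsTo.exists_bound_slice (hDb : IsBounded D) {I : Set ℝ} {f : ℝ → Space d → ℝ}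
    (h : ExtendsTo (I ×ˢ D) (I ×ˢ closure D) f) {t : ℝ} (ht : t ∈ I) :
    ∃ C, ∀ x ∈ D, |f t x| ≤ C :=
  let ⟨C, hC⟩ := h.exists_bound hDb isCompact_singleton (singleton_subset_iff.2 ht)
  ⟨C, hC t rfl ht⟩

theorem ExtendsTo.integrableOn_slice (hD : IsOpen D) (hDb : IsBounded D) {I : Set ℝ}
    {f : ℝ → Space d → ℝ} (h : ExtendsTo (I ×ˢ D) (I ×ˢ closure D) f) {t : ℝ} (ht : t ∈ I) :
    IntegrableOn (f t) D :=
  let ⟨_, hC⟩ := h.exists_bound_slice hDb ht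
  integrableOn_of_continuousOn_of_bound _ hD hDb (h.continuousOn_slice ht) hC

theorem extendsTo_of_continuousOn {I : Set ℝ} {f : ℝ → Space d → ℝ}
    (h : ContinuousOn (fun z : ℝ × Space d => f z.1 z.2) (I ×ˢ closure D)) :
    ExtendsTo (I ×ˢ D) (I ×ˢ closure D) f :=
  ⟨_, h, fun _ _ _ => rfl⟩

theorem ExtendsTo.mul {Q Q' : Set (ℝ × Space d)} {f g : ℝ → Space d → ℝ} (hf : ExtendsTo Q Q' f)
    (hg : ExtendsTo Q Q' g) : ExtendsTo Q Q' fun t x => f t x * g t x :=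
  let ⟨f', hf', hff'⟩ := hf
  let ⟨g', hg', hgg'⟩ := hg
  ⟨_, hf'.mul hg', fun t x hx => by simp [hff' t x hx, hgg' t x hx]⟩

theorem ExtendsTo.add {Q Q' : Set (ℝ × Space d)} {f g : ℝ → Space d → ℝ} (hf : ExtendsTo Q Q' f)
    (hg : ExtendsTo Q Q' g) : ExtendsTo Q Q' fun t x => f t x + g t x :=
  let ⟨f', hf', hff'⟩ := hf
  let ⟨g', hg', hgg'⟩ := hg
  ⟨_, hf'.add hg', fun t x hx => by simp [hff' t x hx, hgg' t x hx]⟩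

theorem ExtendsTo.sum {ι : Type*} (s : Finset ι) {Q Q' : Set (ℝ × Space d)}
    {f : ι → ℝ → Space d → ℝ} (hf : ∀ i, ExtendsTo Q Q' (f i)) :
    ExtendsTo Q Q' fun t x => ∑ i ∈ s, f i t x := by
  choose g hg hgf using hf
  exact ⟨fun z => ∑ i ∈ s, g i z, continuousOn_finsetSum _ fun i _ => hg i, fun t x hx => by
    simp [fun i => hgf i t x hx]⟩

/-- The space integral of a field continuous up to the boundary is continuous in time. -/
theorem continuousOn_setIntegral (hD : IsOpen D) (hDb : IsBounded D) {f : ℝ → Space d → ℝ}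
    (h : ContinuousOn (fun z : ℝ × Space d => f z.1 z.2) (Ico 0 T ×ˢ closure D)) :
    ContinuousOn (fun t => ∫ x in D, f t x) (Ico 0 T) := by
  intro t ht
  have hE := extendsTo_of_continuousOn h
  -- Bounds are uniform only on compact time intervals; one ending midway between `t` and `T` is a
  -- neighbourhood of `t` in `[0, T)`.
  obtain ⟨C, hC⟩ := hE.exists_bound (K := Icc 0 ((t + T) / 2)) hDb isCompact_Icc
    fun s hs => ⟨hs.1, by linarith [hs.2, ht.2]⟩
  have : IsFiniteMeasure (volume.restrict D) := ⟨by simpa using hDb.measure_lt_top⟩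
  refine continuousWithinAt_of_dominated (bound := fun _ => C) ?_ ?_ (integrable_const _) ?_
  · filter_upwards [self_mem_nhdsWithin] with s hs
    exact (hE.continuousOn_slice hs).aestronglyMeasurable hD.measurableSet
  · filter_upwards [self_mem_nhdsWithin, mem_nhdsWithin_of_mem_nhds
      (Iio_mem_nhds (show t < (t + T) / 2 by linarith [ht.2]))] with s hs hs'
    filter_upwards [ae_restrict_mem hD.measurableSet] with x hx
      using hC s ⟨hs.1, le_of_lt hs'⟩ hs x hx
  · filter_upwards [ae_restrict_mem hD.measurableSet] with x hx
    exact (h (t, x) ⟨ht, subset_closure hx⟩).comp (f := fun s => (s, x))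
      (by fun_prop) fun s hs => ⟨hs, subset_closure hx⟩

/-! ### Regular scalar fields -/

/-- A scalar field which is continuous up to the boundary and the initial time, and `C¹` up to the
boundary for positive times. -/
structure RegularField (T : ℝ) (D : Set (Space d)) (f : ℝ → Space d → ℝ) : Prop where
  cont : ContinuousOn (fun z : ℝ × Space d => f z.1 z.2) (Ico 0 T ×ˢ closure D)
  time : TimeC1 T D f
  space : SpaceC1 T D f

/-- A divergence-free velocity field which vanishes on the boundary. -/
structure SolenoidalFlow (T : ℝ) (D : Set (Space d)) (u : ℝ → Space d → Space d) : Prop where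
  cont : ContinuousOn (fun z : ℝ × Space d => u z.1 z.2) (Ico 0 T ×ˢ closure D)
  space : ∀ i, SpaceC1 T D (comp u i)
  div_eq_zero : ∀ t ∈ Ioo 0 T, ∀ x ∈ D, ∑ i, dx i (comp u i) t x = 0
  no_slip : ∀ t ∈ Ico 0 T, ∀ x ∈ frontier D, u t x = 0

theorem TimeC1.mono {T' : ℝ} (hT : T' ≤ T) {f : ℝ → Space d → ℝ} (h : TimeC1 T D f) :
    TimeC1 T' D f where
  diff t ht := h.diff t ⟨ht.1, ht.2.trans_le hT⟩
  ext := h.ext.mono (prod_mono (Ioo_subset_Ioo_right hT) subset_rfl)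
    (prod_mono (Ioo_subset_Ioo_right hT) subset_rfl)

theorem SpaceC1.mono {T' : ℝ} (hT : T' ≤ T) {f : ℝ → Space d → ℝ} (h : SpaceC1 T D f) :
    SpaceC1 T' D f where
  diff t ht := h.diff t ⟨ht.1, ht.2.trans_le hT⟩
  ext := h.ext.mono (prod_mono (Ioo_subset_Ioo_right hT) subset_rfl)
    (prod_mono (Ioo_subset_Ioo_right hT) subset_rfl)
  ext_dx j := (h.ext_dx j).mono (prod_mono (Ioo_subset_Ioo_right hT) subset_rfl)
    (prod_mono (Ioo_subset_Ioo_right hT) subset_rfl)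

theorem RegularField.mono {T' : ℝ} (hT : T' ≤ T) {f : ℝ → Space d → ℝ} (h : RegularField T D f) :
    RegularField T' D f where
  cont := h.cont.mono (prod_mono (Ico_subset_Ico_right hT) subset_rfl)
  time := h.time.mono hT
  space := h.space.mono hT

theorem SolenoidalFlow.mono {T' : ℝ} (hT : T' ≤ T) (h : SolenoidalFlow T D u) :
    SolenoidalFlow T' D u where
  cont := h.cont.mono (prod_mono (Ico_subset_Ico_right hT) subset_rfl)
  space i := (h.space i).mono hT
  div_eq_zero t ht := h.div_eq_zero t ⟨ht.1, ht.2.trans_le hT⟩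
  no_slip t ht := h.no_slip t ⟨ht.1, ht.2.trans_le hT⟩

theorem continuousOn_comp
    (h : ContinuousOn (fun z : ℝ × Space d => u z.1 z.2) (Ico 0 T ×ˢ closure D)) (i : Fin d) :
    ContinuousOn (fun z : ℝ × Space d => comp u i z.1 z.2) (Ico 0 T ×ˢ closure D) :=
  (EuclideanSpace.proj (𝕜 := ℝ) i).continuous.comp_continuousOn h

theorem continuousOn_slice_closure {f : ℝ → Space d → ℝ}
    (h : ContinuousOn (fun z : ℝ × Space d => f z.1 z.2) (Ico 0 T ×ˢ closure D)) {t : ℝ}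
    (ht : t ∈ Ico 0 T) : ContinuousOn (f t) (closure D) :=
  h.comp (f := fun x => (t, x)) (by fun_prop) fun _ hx => ⟨ht, hx⟩

section Composition

variable {ι : Type*} [Fintype ι] {F : ι → ℝ → Space d → ℝ} {U : Set (ι → ℝ)} {Φ : (ι → ℝ) → ℝ}
  {Φ' : (ι → ℝ) → (ι → ℝ) →L[ℝ] ℝ}

theorem hasDerivAt_comp_fields (hF : ∀ k, RegularField T D (F k))
    (hΦ : ∀ y ∈ U, HasFDerivAt Φ (Φ' y) y)
    (hU : ∀ t ∈ Ico 0 T, ∀ x ∈ closure D, (fun k => F k t x) ∈ U) {t : ℝ} (ht : t ∈ Ioo 0 T)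
    {x : Space d} (hx : x ∈ D) :
    HasDerivAt (fun s => Φ fun k => F k s x) (Φ' (fun k => F k t x) fun k => dt (F k) t x) t :=
  (hΦ _ (hU t (Ioo_subset_Ico_self ht) x (subset_closure hx))).comp_hasDerivAt t
    (hasDerivAt_pi.2 fun k => ((hF k).time.diff t ht x hx).hasDerivAt)

theorem hasFDerivAt_comp_fields (hF : ∀ k, RegularField T D (F k))
    (hΦ : ∀ y ∈ U, HasFDerivAt Φ (Φ' y) y)
    (hU : ∀ t ∈ Ico 0 T, ∀ x ∈ closure D, (fun k => F k t x) ∈ U) {t : ℝ} (ht : t ∈ Ioo 0 T)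
    {x : Space d} (hx : x ∈ D) :
    HasFDerivAt (fun y => Φ fun k => F k t y)
      ((Φ' fun k => F k t x).comp (ContinuousLinearMap.pi fun k => fderiv ℝ (F k t) x)) x :=
  (hΦ _ (hU t (Ioo_subset_Ico_self ht) x (subset_closure hx))).comp x
    (hasFDerivAt_pi.2 fun k => ((hF k).space.diff t ht x hx).hasFDerivAt)

theorem dx_comp_fields (hF : ∀ k, RegularField T D (F k)) (hΦ : ∀ y ∈ U, HasFDerivAt Φ (Φ' y) y)
    (hU : ∀ t ∈ Ico 0 T, ∀ x ∈ closure D, (fun k => F k t x) ∈ U) {t : ℝ} (ht : t ∈ Ioo 0 T)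
    {x : Space d} (hx : x ∈ D) (j : Fin d) :
    dx j (fun t x => Φ fun k => F k t x) t x
      = Φ' (fun k => F k t x) fun k => dx j (F k) t x := by
  rw [dx, (hasFDerivAt_comp_fields hF hΦ hU ht hx).fderiv]
  rfl

/-- A `C¹` function of regular fields is a regular field. -/
theorem RegularField.comp_fields (hF : ∀ k, RegularField T D (F k))
    (hΦ : ∀ y ∈ U, HasFDerivAt Φ (Φ' y) y) (hΦ' : ContinuousOn Φ' U)
    (hU : ∀ t ∈ Ico 0 T, ∀ x ∈ closure D, (fun k => F k t x) ∈ U) :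
    RegularField T D fun t x => Φ fun k => F k t x := by
  have hc : ContinuousOn (fun z : ℝ × Space d => fun k => F k z.1 z.2) (Ico 0 T ×ˢ closure D) :=
    continuousOn_pi.2 fun k => (hF k).cont
  have hc' : ContinuousOn (fun z : ℝ × Space d => Φ fun k => F k z.1 z.2) (Ico 0 T ×ˢ closure D) :=
    ContinuousOn.comp (t := U) (fun y hy => (hΦ y hy).continuousAt.continuousWithinAt) hc
      fun z hz => hU z.1 hz.1 z.2 hz.2
  have hs : Ioo 0 T ×ˢ closure D ⊆ Ico 0 T ×ˢ closure D :=
    prod_mono Ioo_subset_Ico_self subset_rfl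
  have hc'' : ContinuousOn (fun z : ℝ × Space d => Φ' fun k => F k z.1 z.2)
      (Ioo 0 T ×ˢ closure D) :=
    hΦ'.comp (hc.mono hs) fun z hz => hU z.1 (hs hz).1 z.2 hz.2
  refine ⟨hc', ⟨fun t ht x hx => (hasDerivAt_comp_fields hF hΦ hU ht hx).differentiableAt, ?_⟩,
    ⟨fun t ht x hx => (hasFDerivAt_comp_fields hF hΦ hU ht hx).differentiableAt,
      ⟨_, hc'.mono hs, fun _ _ _ => rfl⟩, fun j => ?_⟩⟩
  · choose g hg hgf using fun k => (hF k).time.ext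
    refine ⟨_, hc''.clm_apply (continuousOn_pi.2 hg), fun t x hx => ?_⟩
    rw [dt, (hasDerivAt_comp_fields hF hΦ hU hx.1 hx.2).deriv]
    simp only [fun k => hgf k t x hx]
  · choose g hg hgf using fun k => (hF k).space.ext_dx j
    refine ⟨_, hc''.clm_apply (continuousOn_pi.2 hg), fun t x hx => ?_⟩
    rw [dx_comp_fields hF hΦ hU hx.1 hx.2]
    simp only [fun k => hgf k t x hx]

/-- The chain rule for the transport derivative. -/
theorem transport_comp_fields (hF : ∀ k, RegularField T D (F k))
    (hΦ : ∀ y ∈ U, HasFDerivAt Φ (Φ' y) y)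
    (hU : ∀ t ∈ Ico 0 T, ∀ x ∈ closure D, (fun k => F k t x) ∈ U) {t : ℝ} (ht : t ∈ Ioo 0 T)
    {x : Space d} (hx : x ∈ D) :
    transport u (fun t x => Φ fun k => F k t x) t x
      = Φ' (fun k => F k t x) fun k => transport u (F k) t x := by
  rw [transport, dt, (hasDerivAt_comp_fields hF hΦ hU ht hx).deriv]
  simp only [dx_comp_fields hF hΦ hU ht hx, transport]
  have : (fun k => dt (F k) t x + ∑ j, u t x j * dx j (F k) t x)
      = (fun k => dt (F k) t x) + ∑ j, u t x j • fun k => dx j (F k) t x := by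
    ext k
    simp
  rw [this, map_add, map_sum]
  simp

end Composition

/-! ### The transport theorem -/

theorem integral_dx_mul (hD : IsOpen D) (hDb : IsBounded D) {w g : ℝ → Space d → ℝ} {t : ℝ}
    (ht : t ∈ Ioo 0 T) (hwc : ContinuousOn (w t) (closure D)) (hw0 : ∀ x ∈ frontier D, w t x = 0)
    (hw : SpaceC1 T D w) (hg : SpaceC1 T D g) (j : Fin d) :
    ∫ x in D, dx j w t x * g t x = -∫ x in D, w t x * dx j g t x :=
  setIntegral_fderiv_mul_eq_neg volume hD hDb hwc hw0 (hw.diff t ht)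
    ((hw.ext_dx j).continuousOn_slice ht) ((hw.ext_dx j).exists_bound_slice hDb ht)
    (hg.diff t ht) ((hg.ext_dx j).continuousOn_slice ht) (hg.ext.exists_bound_slice hDb ht)
    ((hg.ext_dx j).exists_bound_slice hDb ht)

theorem SolenoidalFlow.integral_velocity_mul_dx (hD : IsOpen D) (hDb : IsBounded D)
    (hu : SolenoidalFlow T D u) {f : ℝ → Space d → ℝ} {t : ℝ} (ht : t ∈ Ioo 0 T)
    (hf : SpaceC1 T D f) (i j : Fin d) :
    ∫ x in D, u t x i * dx j f t x = -∫ x in D, dx j (comp u i) t x * f t x := by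
  have ht' := Ioo_subset_Ico_self ht
  rw [integral_dx_mul hD hDb ht (continuousOn_slice_closure (continuousOn_comp hu.cont i) ht')
    (fun x hx => by simp [comp, hu.no_slip t ht' x hx]) (hu.space i) hf j, neg_neg]
  rfl

/-- Integrating by parts moves the derivatives onto `u`, where they form `div u = 0`. No boundary
condition on `f` is needed, so the pressure is covered as well. -/
theorem SolenoidalFlow.integral_convection (hD : IsOpen D) (hDb : IsBounded D)
    (hu : SolenoidalFlow T D u) {f : ℝ → Space d → ℝ} {t : ℝ} (ht : t ∈ Ioo 0 T)
    (hf : SpaceC1 T D f) : ∫ x in D, ∑ j, u t x j * dx j f t x = 0 := by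
  rw [integral_finsetSum (f := fun j x => u t x j * dx j f t x) _ fun j _ =>
    ((hu.space j).ext.mul (hf.ext_dx j)).integrableOn_slice hD hDb ht]
  simp only [hu.integral_velocity_mul_dx hD hDb ht hf, Finset.sum_neg_distrib]
  rw [← integral_finsetSum _ fun j _ =>
    (((hu.space j).ext_dx j).mul hf.ext).integrableOn_slice hD hDb ht, neg_eq_zero]
  refine setIntegral_eq_zero_of_forall_eq_zero fun x hx => ?_
  rw [← Finset.sum_mul, hu.div_eq_zero t ht x hx, zero_mul]

theorem SolenoidalFlow.extendsTo_transport (hu : SolenoidalFlow T D u) {f : ℝ → Space d → ℝ}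
    (hf : RegularField T D f) :
    ExtendsTo (Ioo 0 T ×ˢ D) (Ioo 0 T ×ˢ closure D) (transport u f) :=
  hf.time.ext.add (ExtendsTo.sum _ fun j => (hu.space j).ext.mul (hf.space.ext_dx j))

/-- Differentiation under the integral gives `∫ ∂f/∂t`; the convective part can be added since its
integral is zero. -/
theorem RegularField.hasDerivAt_integral (hD : IsOpen D) (hDb : IsBounded D)
    (hu : SolenoidalFlow T D u) {f : ℝ → Space d → ℝ} (hf : RegularField T D f) {t : ℝ}
    (ht : t ∈ Ioo 0 T) :
    HasDerivAt (fun s => ∫ x in D, f s x) (∫ x in D, transport u f t x) t := by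
  have hE := extendsTo_of_continuousOn hf.cont
  obtain ⟨r, hr, hball⟩ := Metric.nhds_basis_closedBall.mem_iff.1 (isOpen_Ioo.mem_nhds ht)
  obtain ⟨C, hC⟩ := hf.time.ext.exists_bound hDb (isCompact_closedBall t r) hball
  have : IsFiniteMeasure (volume.restrict D) := ⟨by simpa using hDb.measure_lt_top⟩
  have h := (hasDerivAt_integral_of_dominated_loc_of_deriv_le (μ := volume.restrict D)
    (F := f) (F' := dt f) (bound := fun _ => C) (x₀ := t) (Metric.closedBall_mem_nhds t hr) ?_
    (hE.integrableOn_slice hD hDb (Ioo_subset_Ico_self ht))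
    ((hf.time.ext.continuousOn_slice ht).aestronglyMeasurable hD.measurableSet) ?_
    (integrable_const _) ?_).2
  · refine h.congr_deriv ?_
    refine (add_zero _).symm.trans ?_
    rw [← hu.integral_convection hD hDb ht hf.space]
    exact (integral_add (hf.time.ext.integrableOn_slice hD hDb ht)
      ((ExtendsTo.sum _ fun j =>
        (hu.space j).ext.mul (hf.space.ext_dx j)).integrableOn_slice hD hDb ht)).symm
  · filter_upwards [isOpen_Ioo.mem_nhds ht] with s hs
    exact (hE.continuousOn_slice (Ioo_subset_Ico_self hs)).aestronglyMeasurable hD.measurableSet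
  · filter_upwards [ae_restrict_mem hD.measurableSet] with x hx s hs
      using hC s hs (hball hs) x hx
  · filter_upwards [ae_restrict_mem hD.measurableSet] with x hx s hs
      using (hf.time.diff s (hball hs) x hx).hasDerivAt

/-- A nonnegative field vanishing initially, whose transport derivative is controlled by the field,
vanishes. -/
theorem RegularField.eq_zero_of_transport_le (hD : IsOpen D) (hDb : IsBounded D)
    (hu : SolenoidalFlow T D u) {f : ℝ → Space d → ℝ} (hf : RegularField T D f) {C : ℝ}
    (h0 : ∀ x ∈ D, f 0 x = 0) (hpos : ∀ t ∈ Ico 0 T, ∀ x ∈ D, 0 ≤ f t x)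
    (hle : ∀ t ∈ Ioo 0 T, ∀ x ∈ D, transport u f t x ≤ C * f t x) :
    ∀ t ∈ Ico 0 T, ∀ x ∈ closure D, f t x = 0 := by
  intro t ht
  have hE := extendsTo_of_continuousOn hf.cont
  let J : ℝ → ℝ := fun s => ∫ x in D, f s x
  have hJc : ContinuousOn J (Ico 0 T) := continuousOn_setIntegral hD hDb hf.cont
  have hIcc : Icc 0 t ⊆ Ico 0 T := fun s hs => ⟨hs.1, hs.2.trans_lt ht.2⟩
  -- Grönwall's argument: with the integrating factor the integral of `f` is nonincreasing, and it
  -- starts from zero.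
  have hder : ∀ s ∈ Ioo 0 T, HasDerivAt (fun s => Real.exp (-C * s) * J s)
      (Real.exp (-C * s) * ((∫ x in D, transport u f s x) - C * J s)) s := fun s hs => by
    have h1 : HasDerivAt (fun s => Real.exp (-C * s)) (Real.exp (-C * s) * -C) s := by
      simpa using ((hasDerivAt_id s).const_mul (-C)).exp
    refine (h1.mul (hf.hasDerivAt_integral hD hDb hu hs)).congr_deriv ?_
    ring
  have hanti : AntitoneOn (fun s => Real.exp (-C * s) * J s) (Icc 0 t) := by
    refine antitoneOn_of_deriv_nonpos (convex_Icc 0 t)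
      ((by fun_prop : ContinuousOn (fun s => Real.exp (-C * s)) _).mul (hJc.mono hIcc)) ?_ ?_
    · intro s hs
      rw [interior_Icc] at hs
      exact (hder s ⟨hs.1, hs.2.trans ht.2⟩).differentiableAt.differentiableWithinAt
    · intro s hs
      rw [interior_Icc] at hs
      have hs' : s ∈ Ioo 0 T := ⟨hs.1, hs.2.trans ht.2⟩
      rw [(hder s hs').deriv]
      refine mul_nonpos_of_nonneg_of_nonpos (Real.exp_pos _).le (sub_nonpos.2 ?_)
      simp only [J]
      rw [← integral_const_mul]
      exact setIntegral_mono_on ((hu.extendsTo_transport hf).integrableOn_slice hD hDb hs')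
        ((hE.integrableOn_slice hD hDb (Ioo_subset_Ico_self hs')).const_mul C)
        hD.measurableSet (hle s hs')
  have hJ0 : J 0 = 0 := setIntegral_eq_zero_of_forall_eq_zero h0
  have hJt : J t ≤ 0 := by
    have := hanti (left_mem_Icc.2 ht.1) (right_mem_Icc.2 ht.1) ht.1
    simp only [hJ0, mul_zero] at this
    exact nonpos_of_mul_nonpos_right this (Real.exp_pos _)
  have hae : 0 ≤ᵐ[volume.restrict D] f t := by
    filter_upwards [ae_restrict_mem hD.measurableSet] with x hx using hpos t ht x hx
  have h0 : f t =ᵐ[volume.restrict D] 0 :=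
    (setIntegral_eq_zero_iff_of_nonneg_ae hae (hE.integrableOn_slice hD hDb ht)).1
      (le_antisymm hJt (setIntegral_nonneg hD.measurableSet (hpos t ht)))
  have hD0 : EqOn (f t) 0 D := Measure.eqOn_open_of_ae_eq h0 hD (hE.continuousOn_slice ht)
    continuousOn_const
  exact hD0.of_subset_closure (continuousOn_slice_closure hf.cont ht) continuousOn_const
    subset_closure subset_rfl

theorem regularField_time : RegularField T D fun t _ => t where
  cont := by fun_prop
  time := ⟨fun t _ x _ => differentiableAt_id, fun _ => 1, continuousOn_const, fun t x _ => by
    simp [dt]⟩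
  space := ⟨fun t _ x _ => differentiableAt_const _, ⟨fun z => z.1, by fun_prop, fun _ _ _ => rfl⟩,
    fun j => ⟨fun _ => 0, continuousOn_const, fun t x _ => by simp [dx]⟩⟩

theorem transport_time (t : ℝ) (x : Space d) : transport u (fun t _ => t) t x = 1 := by
  simp [transport, dt, dx]

/-- The minimum principle for the transport equation. -/
theorem RegularField.le_of_le_transport (hD : IsOpen D) (hDb : IsBounded D)
    (hu : SolenoidalFlow T D u) {f : ℝ → Space d → ℝ} (hf : RegularField T D f) {m K : ℝ}
    (h0 : ∀ x ∈ D, m ≤ f 0 x) (hle : ∀ t ∈ Ioo 0 T, ∀ x ∈ D, -K ≤ transport u f t x) :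
    ∀ t ∈ Ico 0 T, ∀ x ∈ closure D, m - K * t ≤ f t x := by
  -- Time is treated as a field of its own, so that the deficit `m - K t - f` is a function of
  -- regular fields.
  let F : Fin 2 → ℝ → Space d → ℝ := ![fun t _ => t, f]
  have hF : ∀ k, RegularField T D (F k) := by
    intro k
    fin_cases k
    exacts [regularField_time, hf]
  -- A smooth substitute for the positive part: nonnegative, nondecreasing, and zero exactly on the
  -- nonpositive numbers.
  let ψ := Real.smoothTransition
  have hψ : ContDiff ℝ 1 ψ := Real.smoothTransition.contDiff (n := 1)
  let ℓ : (Fin 2 → ℝ) →L[ℝ] ℝ :=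
    -(K • ContinuousLinearMap.proj 0 + ContinuousLinearMap.proj 1)
  let Φ : (Fin 2 → ℝ) → ℝ := fun y => ψ (m - K * y 0 - y 1)
  let Φ' : (Fin 2 → ℝ) → (Fin 2 → ℝ) →L[ℝ] ℝ := fun y => deriv ψ (m - K * y 0 - y 1) • ℓ
  have hΦ : ∀ y ∈ (univ : Set (Fin 2 → ℝ)), HasFDerivAt Φ (Φ' y) y := fun y _ => by
    have h1 : HasFDerivAt (fun y : Fin 2 → ℝ => m - K * y 0 - y 1) ℓ y := by
      refine (ℓ.hasFDerivAt.const_add m).congr_of_eventuallyEq (Eventually.of_forall fun y => ?_)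
      simp [ℓ]
      ring
    exact ((hψ.differentiable one_ne_zero _).hasDerivAt).comp_hasFDerivAt y h1
  have hΦ' : ContinuousOn Φ' univ := by
    refine Continuous.continuousOn (((hψ.continuous_deriv le_rfl).comp ?_).smul continuous_const)
    fun_prop
  have hU : ∀ t ∈ Ico 0 T, ∀ x ∈ closure D, (fun k => F k t x) ∈ (univ : Set (Fin 2 → ℝ)) :=
    fun _ _ _ _ => mem_univ _
  have hreg := RegularField.comp_fields hF hΦ hΦ' hU
  have hzero := hreg.eq_zero_of_transport_le hD hDb hu (C := 0) ?_ ?_ ?_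
  · intro t ht x hx
    have := Real.smoothTransition.zero_iff_nonpos.1 (hzero t ht x hx)
    simp only [F, Matrix.cons_val_zero, Matrix.cons_val_one] at this
    linarith
  · intro x hx
    refine Real.smoothTransition.zero_of_nonpos ?_
    have := h0 x hx
    simp only [F, Matrix.cons_val_zero, Matrix.cons_val_one]
    linarith
  · exact fun t _ x _ => Real.smoothTransition.nonneg _
  · intro t ht x hx
    rw [transport_comp_fields hF hΦ hU ht hx, zero_mul]
    have h1 : 0 ≤ deriv ψ (m - K * t - f t x) := Real.smoothTransition.monotone.deriv_nonneg
    have h2 := hle t ht x hx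
    have h3 : Φ' (fun k => F k t x) (fun k => transport u (F k) t x)
        = deriv ψ (m - K * t - f t x) * (-(K + transport u f t x)) := by
      simp [Φ', F, ℓ, transport_time]
      ring
    rw [h3]
    exact mul_nonpos_of_nonneg_of_nonpos h1 (by linarith)

end Transport

/-! ### Entropy and determinant as functions of a matrix -/

section MatrixFunctions

/-! ### Positive definite matrices -/

/-- This is the form in which relaxation appears once `A - I` is contracted with `I - A⁻¹`. -/
theorem relaxDensity_eq {A : Mat d} (hA : A.det ≠ 0) :
    relaxDensity A = A.trace - 2 * d + A⁻¹.trace := by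
  have hu : IsUnit A.det := isUnit_iff_ne_zero.2 hA
  have h : (1 - A⁻¹) ^ 2 * A = A - (1 + 1) + A⁻¹ := by
    have h1 : A⁻¹ * A = 1 := Matrix.nonsing_inv_mul A hu
    have h2 : A⁻¹ * A⁻¹ * A = A⁻¹ := by rw [mul_assoc, h1, mul_one]
    calc (1 - A⁻¹) ^ 2 * A = A - (A⁻¹ * A + A⁻¹ * A) + A⁻¹ * A⁻¹ * A := by noncomm_ring
      _ = _ := by rw [h1, h2]
  rw [relaxDensity, h, Matrix.trace_add, Matrix.trace_sub, Matrix.trace_add, Matrix.trace_one,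
    Fintype.card_fin, two_mul]

/-- Since `A⁻¹` commutes with `A`, the matrix equals `(I - A⁻¹) A (I - A⁻¹)`, which is congruent to
a positive one. -/
theorem relaxDensity_nonneg {A : Mat d} (hA : A.PosDef) : 0 ≤ relaxDensity A := by
  have hu : IsUnit A.det := isUnit_iff_ne_zero.2 hA.det_pos.ne'
  have h1 : A⁻¹ * A = 1 := Matrix.nonsing_inv_mul A hu
  have h2 : A * A⁻¹ = 1 := Matrix.mul_nonsing_inv A hu
  have hH : (1 - A⁻¹).conjTranspose = 1 - A⁻¹ := by
    rw [Matrix.conjTranspose_sub, Matrix.conjTranspose_one, hA.inv.isHermitian.eq]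
  have h := (hA.posSemidef.conjTranspose_mul_mul_same (1 - A⁻¹)).trace_nonneg
  rw [hH] at h
  have h3 : (1 - A⁻¹) ^ 2 * A = (1 - A⁻¹) * A * (1 - A⁻¹) := by
    rw [pow_two, mul_assoc, mul_assoc, sub_mul 1 A⁻¹ A, mul_sub A 1 A⁻¹, h1, h2, one_mul, mul_one]
  rwa [relaxDensity, h3]

/-- The spectral form turns matrix inequalities for the entropy into scalar ones for eigenvalues. -/
theorem entropyDensity_eq_sum {A : Mat d} (hA : A.PosDef) :
    entropyDensity A
      = ∑ i, (hA.isHermitian.eigenvalues i - 1 - Real.log (hA.isHermitian.eigenvalues i)) := by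
  rw [entropyDensity, hA.isHermitian.det_eq_prod_eigenvalues,
    hA.isHermitian.trace_eq_sum_eigenvalues]
  simp only [RCLike.ofReal_real_eq_id, id]
  rw [Real.log_prod fun i _ => (hA.eigenvalues_pos i).ne']
  simp only [Finset.sum_sub_distrib, Finset.sum_const, Finset.card_univ, Fintype.card_fin,
    nsmul_eq_mul, mul_one]
  ring

theorem entropyDensity_nonneg {A : Mat d} (hA : A.PosDef) : 0 ≤ entropyDensity A := by
  rw [entropyDensity_eq_sum hA]
  refine Finset.sum_nonneg fun i _ => ?_
  have := Real.log_le_sub_one_of_pos (hA.eigenvalues_pos i)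
  linarith

theorem normSq_eq_trace (M : Mat d) : normSq M = (M * M.transpose).trace := by
  simp [normSq, Matrix.trace, Matrix.mul_apply, pow_two]

theorem normSq_sub_one {A : Mat d} (hA : A.IsHermitian) :
    normSq (A - 1) = ∑ i, (hA.eigenvalues i - 1) ^ 2 := by
  have hT : (A - 1).transpose = A - 1 := by
    have : A.transpose = A := by simpa [Matrix.IsHermitian] using hA
    rw [Matrix.transpose_sub, Matrix.transpose_one, this]
  rw [normSq_eq_trace, hT]
  conv_lhs => rw [hA.spectral_theorem]
  rw [← map_one (Unitary.conjStarAlgAut ℝ _ hA.eigenvectorUnitary), ← map_sub, ← map_mul,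
    Unitary.conjStarAlgAut_apply, Matrix.trace_mul_cycle, Unitary.coe_star_mul_self, one_mul,
    ← Matrix.diagonal_one, Matrix.diagonal_sub, Matrix.diagonal_mul_diagonal,
    Matrix.trace_diagonal]
  simp [pow_two]

/-- Each eigenvalue satisfies `|λ - 1| ≤ 2 (λ - 1 - ln λ) + 1`. The factor 2 becomes the 4 in the
stress bound, and the summand 1 becomes its term in `d`. -/
theorem sqrt_normSq_sub_one_le {A : Mat d} (hA : A.PosDef) :
    √(normSq (A - 1)) ≤ 2 * entropyDensity A + d := by
  rw [normSq_sub_one hA.isHermitian, entropyDensity_eq_sum hA]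
  set ev := hA.isHermitian.eigenvalues with hev
  have hpos : ∀ i, 0 < ev i := hA.eigenvalues_pos
  calc √(∑ i, (ev i - 1) ^ 2) ≤ ∑ i, |ev i - 1| := by
        refine Real.sqrt_le_iff.2 ⟨Finset.sum_nonneg fun i _ => abs_nonneg _, ?_⟩
        simp_rw [← sq_abs (ev _ - 1)]
        exact Finset.sum_sq_le_sq_sum_of_nonneg fun i _ => abs_nonneg _
    _ ≤ ∑ i, (2 * (ev i - 1 - Real.log (ev i)) + 1) := Finset.sum_le_sum fun i _ => by
        have h1 := Real.log_le_sub_one_of_pos (hpos i)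
        -- The case `λ ≥ 1` amounts to `2 ln λ ≤ λ`; the tangent to the logarithm at 2 gives it, as
        -- `ln 2 < 1`.
        have h2 := Real.log_le_sub_one_of_pos (half_pos (hpos i))
        rw [Real.log_div (hpos i).ne' two_ne_zero] at h2
        have h3 := Real.log_two_lt_d9
        refine abs_le.2 ⟨by have := hpos i; linarith, by linarith⟩
    _ = _ := by rw [Finset.sum_add_distrib, ← Finset.mul_sum]; simp

/-! ### Derivatives of functions of the determinant -/

/-- The matrix with the given entries. -/
def matOf (y : Fin d × Fin d → ℝ) : Mat d := Matrix.of fun i j => y (i, j)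

/-- Matrix fields are handled as families of scalar fields indexed by pairs, to which the chain rule
for regular fields applies. With `c = We / ε` the affine expression is the conformation tensor. -/
theorem contDiff_det_affine (c : ℝ) :
    ContDiff ℝ 1 fun y : Fin d × Fin d → ℝ => (c • matOf y + 1).det := by
  simp only [Matrix.det_apply, matOf, Matrix.add_apply, Matrix.smul_apply, Matrix.of_apply]
  refine ContDiff.sum fun σ _ => ContDiff.const_smul _ (contDiff_prod fun i _ => ?_)
  fun_prop

/-- The determinant is `1 + r tr M` plus `r²` times a polynomial in `r`. -/
theorem hasDerivAt_det_one_add_smul (M : Mat d) :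
    HasDerivAt (fun r : ℝ => (1 + r • M).det) M.trace 0 := by
  rw [funext fun r : ℝ => Matrix.det_one_add_smul r M]
  set q := (Matrix.det (1 + (Polynomial.X : Polynomial ℝ) • M.map Polynomial.C)).divX.divX
  have h := (((hasDerivAt_id (0 : ℝ)).const_mul M.trace).const_add 1).add
    ((q.hasDerivAt 0).mul ((hasDerivAt_id (0 : ℝ)).pow 2))
  refine h.congr_deriv ?_
  simp

/-- Jacobi's formula. -/
theorem fderiv_det_affine (c : ℝ) {y : Fin d × Fin d → ℝ} (hy : (c • matOf y + 1).det ≠ 0)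
    (h : Fin d × Fin d → ℝ) :
    fderiv ℝ (fun y : Fin d × Fin d → ℝ => (c • matOf y + 1).det) y h
      = (c • matOf y + 1).det * ((c • matOf y + 1)⁻¹ * (c • matOf h)).trace := by
  set A := c • matOf y + 1 with hAdef
  have hu : IsUnit A.det := isUnit_iff_ne_zero.2 hy
  have h1 : HasDerivAt (fun r : ℝ => y + r • h) h 0 := by
    simpa using ((hasDerivAt_id (0 : ℝ)).smul_const h).const_add y
  have h2 : HasDerivAt (fun r : ℝ => (c • matOf (y + r • h) + 1).det)
      (fderiv ℝ (fun y : Fin d × Fin d → ℝ => (c • matOf y + 1).det) y h) 0 := by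
    have := ((contDiff_det_affine c).differentiable one_ne_zero y).hasFDerivAt
    exact HasFDerivAt.comp_hasDerivAt (f := fun r : ℝ => y + r • h) 0
      (by rwa [zero_smul, add_zero]) h1
  -- Factoring out `A` reduces the derivative at `A` to the derivative at the identity.
  refine h2.unique (((hasDerivAt_det_one_add_smul (A⁻¹ * (c • matOf h))).const_mul
    A.det).congr_of_eventuallyEq (Eventually.of_forall fun r => ?_))
  simp only
  rw [← Matrix.det_mul, mul_add, mul_one, Matrix.mul_smul, ← mul_assoc,
    Matrix.mul_nonsing_inv A hu, one_mul]
  congr 1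
  ext i j
  simp [hAdef, matOf]
  ring

/-- Only the determinant matters for differentiability. This set is open among all matrices, while
for `d ≥ 2` the symmetric positive definite ones are not. -/
theorem isOpen_det_affine_pos (c : ℝ) :
    IsOpen {y : Fin d × Fin d → ℝ | 0 < (c • matOf y + 1).det} :=
  isOpen_lt continuous_const (contDiff_det_affine c).continuous

theorem contDiffOn_log_det_affine (c : ℝ) :
    ContDiffOn ℝ 1 (fun y : Fin d × Fin d → ℝ => Real.log (c • matOf y + 1).det)
      {y | 0 < (c • matOf y + 1).det} :=
  (contDiff_det_affine c).contDiffOn.log fun _ hy => ne_of_gt hy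

theorem fderiv_log_det_affine (c : ℝ) {y : Fin d × Fin d → ℝ} (hy : 0 < (c • matOf y + 1).det)
    (h : Fin d × Fin d → ℝ) :
    fderiv ℝ (fun y : Fin d × Fin d → ℝ => Real.log (c • matOf y + 1).det) y h
      = ((c • matOf y + 1)⁻¹ * (c • matOf h)).trace := by
  rw [((contDiff_det_affine c).differentiable one_ne_zero y).hasFDerivAt.log hy.ne' |>.fderiv]
  simp only [_root_.smul_apply, fderiv_det_affine c hy.ne', smul_eq_mul]
  rw [← mul_assoc, inv_mul_cancel₀ hy.ne', one_mul]

theorem contDiff_trace_affine (c : ℝ) :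
    ContDiff ℝ 1 fun y : Fin d × Fin d → ℝ => (c • matOf y + 1).trace := by
  simp only [Matrix.trace, Matrix.diag, matOf, Matrix.add_apply, Matrix.smul_apply,
    Matrix.of_apply]
  fun_prop

theorem fderiv_trace_affine (c : ℝ) (y h : Fin d × Fin d → ℝ) :
    fderiv ℝ (fun y : Fin d × Fin d → ℝ => (c • matOf y + 1).trace) y h
      = (c • matOf h).trace := by
  have h1 : HasDerivAt (fun r : ℝ => y + r • h) h 0 := by
    simpa using ((hasDerivAt_id (0 : ℝ)).smul_const h).const_add y
  have h2 : HasDerivAt (fun r : ℝ => (c • matOf (y + r • h) + 1).trace)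
      (fderiv ℝ (fun y : Fin d × Fin d → ℝ => (c • matOf y + 1).trace) y h) 0 := by
    have := ((contDiff_trace_affine c).differentiable one_ne_zero y).hasFDerivAt
    exact HasFDerivAt.comp_hasDerivAt (f := fun r : ℝ => y + r • h) 0
      (by rwa [zero_smul, add_zero]) h1
  refine h2.unique (((((hasDerivAt_id (0 : ℝ)).mul_const (c • matOf h).trace).const_add
    (c • matOf y + 1).trace).congr_deriv (one_mul _)).congr_of_eventuallyEq
      (Eventually.of_forall fun r => ?_))
  simp only [id]
  rw [← smul_eq_mul, ← Matrix.trace_smul, ← Matrix.trace_add]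
  congr 1
  ext i j
  simp [matOf]
  ring

theorem contDiffOn_entropyDensity_affine (c : ℝ) :
    ContDiffOn ℝ 1 (fun y : Fin d × Fin d → ℝ => entropyDensity (c • matOf y + 1))
      {y | 0 < (c • matOf y + 1).det} :=
  ((contDiffOn_log_det_affine c).neg.sub contDiffOn_const).add (contDiff_trace_affine c).contDiffOn

theorem fderiv_entropyDensity_affine (c : ℝ) {y : Fin d × Fin d → ℝ}
    (hy : 0 < (c • matOf y + 1).det) (h : Fin d × Fin d → ℝ) :
    fderiv ℝ (fun y : Fin d × Fin d → ℝ => entropyDensity (c • matOf y + 1)) y h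
      = (c • matOf h).trace - ((c • matOf y + 1)⁻¹ * (c • matOf h)).trace := by
  have h1 : HasFDerivAt (fun y : Fin d × Fin d → ℝ => Real.log (c • matOf y + 1).det) _ y :=
    (((contDiffOn_log_det_affine c).contDiffAt
      ((isOpen_det_affine_pos c).mem_nhds hy)).differentiableAt one_ne_zero).hasFDerivAt
  have h2 := ((contDiff_trace_affine (d := d) c).differentiable one_ne_zero y).hasFDerivAt
  have h3 := (h1.neg.sub_const (d : ℝ)).add h2
  have h4 : HasFDerivAt (fun y : Fin d × Fin d → ℝ => entropyDensity (c • matOf y + 1)) _ y := h3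
  rw [h4.fderiv]
  simp only [_root_.add_apply, _root_.neg_apply,
    fderiv_log_det_affine c hy, fderiv_trace_affine]
  ring

/-- Continuously differentiable functions of regular fields are regular fields. -/
theorem RegularField.comp_contDiffOn {ι : Type*} [Fintype ι] {T : ℝ} {D : Set (Space d)}
    {F : ι → ℝ → Space d → ℝ} {U : Set (ι → ℝ)} {Φ : (ι → ℝ) → ℝ}
    (hF : ∀ k, RegularField T D (F k)) (hUo : IsOpen U) (hΦ : ContDiffOn ℝ 1 Φ U)
    (hU : ∀ t ∈ Ico 0 T, ∀ x ∈ closure D, (fun k => F k t x) ∈ U) :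
    RegularField T D (fun t x => Φ fun k => F k t x) :=
  RegularField.comp_fields hF
    (fun _ hy => ((hΦ.contDiffAt (hUo.mem_nhds hy)).differentiableAt one_ne_zero).hasFDerivAt)
    (hΦ.continuousOn_fderiv_of_isOpen hUo le_rfl) hU

theorem transport_comp_contDiffOn {ι : Type*} [Fintype ι] {T : ℝ} {D : Set (Space d)}
    {u : ℝ → Space d → Space d}
    {F : ι → ℝ → Space d → ℝ} {U : Set (ι → ℝ)} {Φ : (ι → ℝ) → ℝ}
    (hF : ∀ k, RegularField T D (F k)) (hUo : IsOpen U) (hΦ : ContDiffOn ℝ 1 Φ U)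
    (hU : ∀ t ∈ Ico 0 T, ∀ x ∈ closure D, (fun k => F k t x) ∈ U) {t : ℝ} (ht : t ∈ Ioo 0 T)
    {x : Space d} (hx : x ∈ D) :
    transport u (fun t x => Φ fun k => F k t x) t x
      = fderiv ℝ Φ (fun k => F k t x) fun k => transport u (F k) t x :=
  transport_comp_fields hF
    (fun _ hy => ((hΦ.contDiffAt (hUo.mem_nhds hy)).differentiableAt one_ne_zero).hasFDerivAt)
    hU ht hx

end MatrixFunctions

/-! ### Symmetry and positivity of the conformation tensor -/

section Conformation

variable {D : Set (Space d)} {T Re We ε : ℝ} {u : ℝ → Space d → Space d} {p : ℝ → Space d → ℝ}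
  {τ : ℝ → Space d → Mat d}

/-! ### Consequences of the regularity of a solution -/

theorem IsSolution.solenoidalFlow (hreg : IsRegular T D u p τ)
    (hsol : IsSolution T D Re We ε u p τ) : SolenoidalFlow T D u :=
  ⟨hreg.u_cont, hreg.u_space, hsol.incompressible, hsol.no_slip⟩

theorem IsRegular.velocity (hreg : IsRegular T D u p τ) (i : Fin d) :
    RegularField T D (comp u i) :=
  ⟨continuousOn_comp hreg.u_cont i, hreg.u_time i, hreg.u_space i⟩

theorem IsRegular.stress (hreg : IsRegular T D u p τ) (k : Fin d × Fin d) :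
    RegularField T D (entry τ k.1 k.2) :=
  ⟨(continuous_id.matrix_elem k.1 k.2).comp_continuousOn hreg.τ_cont,
    hreg.τ_time k.1 k.2, hreg.τ_space k.1 k.2⟩

theorem IsRegular.conformation_cont (hreg : IsRegular T D u p τ) :
    ContinuousOn (fun z : ℝ × Space d => conformation We ε τ z.1 z.2) (Ico 0 T ×ˢ closure D) :=
  (hreg.τ_cont.const_smul (We / ε)).add continuousOn_const

/-! ### Symmetry of the stress -/

theorem normSq_nonneg (M : Mat d) : 0 ≤ normSq M :=
  Finset.sum_nonneg fun _ _ => Finset.sum_nonneg fun _ _ => sq_nonneg _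

theorem normSq_transpose (M : Mat d) : normSq M.transpose = normSq M := by
  simp only [normSq, Matrix.transpose_apply]
  exact Finset.sum_comm

theorem normSq_eq_zero {M : Mat d} (h : normSq M = 0) : M = 0 := by
  ext i j
  have h1 := (Finset.sum_eq_zero_iff_of_nonneg fun i _ =>
    Finset.sum_nonneg fun j _ => sq_nonneg (M i j)).1 h i (Finset.mem_univ i)
  have h2 := (Finset.sum_eq_zero_iff_of_nonneg fun j _ => sq_nonneg (M i j)).1 h1 j
    (Finset.mem_univ j)
  simpa using h2

/-- Young's inequality on each product of entries; every square is then counted `d` times in each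
half. -/
theorem sum_mul_mul_le {G : Mat d} {M : ℝ} (hG : ∀ i j, |G i j| ≤ M) (S : Mat d) :
    ∑ i, ∑ j, S i j * (G * S) i j ≤ M * d * normSq S := by
  have h : ∀ i j k, S i j * (G i k * S k j) ≤ M * (S i j ^ 2 / 2) + M * (S k j ^ 2 / 2) := by
    intro i j k
    have h1 : |S i j * S k j| ≤ (S i j ^ 2 + S k j ^ 2) / 2 := by
      rw [abs_mul, ← sq_abs (S i j), ← sq_abs (S k j)]
      nlinarith [sq_nonneg (|S i j| - |S k j|)]
    calc S i j * (G i k * S k j) ≤ |G i k * (S i j * S k j)| := by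
          rw [mul_left_comm]; exact le_abs_self _
      _ ≤ M * ((S i j ^ 2 + S k j ^ 2) / 2) := by
          rw [abs_mul]
          exact mul_le_mul (hG i k) h1 (abs_nonneg _) ((abs_nonneg _).trans (hG i k))
      _ = _ := by ring
  calc ∑ i, ∑ j, S i j * (G * S) i j = ∑ i, ∑ j, ∑ k, S i j * (G i k * S k j) := by
        simp only [Matrix.mul_apply, Finset.mul_sum]
    _ ≤ ∑ i, ∑ j, ∑ k, (M * (S i j ^ 2 / 2) + M * (S k j ^ 2 / 2)) :=
        Finset.sum_le_sum fun i _ => Finset.sum_le_sum fun j _ => Finset.sum_le_sum fun k _ =>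
          h i j k
    _ = M * d * normSq S := by
        have h2 : ∑ i : Fin d, ∑ j : Fin d, ∑ k : Fin d, M * (S k j ^ 2 / 2)
            = d * (M / 2 * normSq S) := by
          rw [Finset.sum_const, Finset.card_univ, Fintype.card_fin, nsmul_eq_mul, Finset.sum_comm,
            normSq, Finset.mul_sum]
          simp only [Finset.mul_sum]
          refine Finset.sum_congr rfl fun i _ => Finset.sum_congr rfl fun j _ => ?_
          ring
        have h3 : ∑ i : Fin d, ∑ j : Fin d, ∑ k : Fin d, M * (S i j ^ 2 / 2)
            = d * (M / 2 * normSq S) := by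
          simp only [Finset.sum_const, Finset.card_univ, Fintype.card_fin, nsmul_eq_mul, normSq,
            Finset.mul_sum]
          refine Finset.sum_congr rfl fun i _ => Finset.sum_congr rfl fun j _ => ?_
          ring
        simp only [Finset.sum_add_distrib]
        rw [h2, h3]
        ring

theorem contDiff_normSq_sub_transpose :
    ContDiff ℝ 1 fun y : Fin d × Fin d → ℝ => normSq (matOf y - (matOf y).transpose) := by
  simp only [normSq, matOf, Matrix.sub_apply, Matrix.transpose_apply, Matrix.of_apply]
  fun_prop

theorem fderiv_normSq_sub_transpose (y h : Fin d × Fin d → ℝ) :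
    fderiv ℝ (fun y : Fin d × Fin d → ℝ => normSq (matOf y - (matOf y).transpose)) y h
      = ∑ i, ∑ j, 2 * ((matOf y - (matOf y).transpose) i j
          * (matOf h - (matOf h).transpose) i j) := by
  have h1 : ∀ i j : Fin d,
      HasFDerivAt (fun y : Fin d × Fin d → ℝ => (y (i, j) - y (j, i)) ^ 2) _ y :=
    fun i j => ((ContinuousLinearMap.proj (R := ℝ) (φ := fun _ : Fin d × Fin d => ℝ)
      (i, j)).hasFDerivAt.sub (ContinuousLinearMap.proj (R := ℝ) (j, i)).hasFDerivAt).pow 2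
  have h2 := HasFDerivAt.fun_sum (u := Finset.univ) fun i _ =>
    HasFDerivAt.fun_sum (u := Finset.univ) fun j _ => h1 i j
  have h3 : HasFDerivAt
      (fun y : Fin d × Fin d → ℝ => normSq (matOf y - (matOf y).transpose)) _ y := h2
  rw [h3.fderiv]
  simp only [_root_.sum_apply]
  refine Finset.sum_congr rfl fun i _ => Finset.sum_congr rfl fun j _ => ?_
  simp [matOf]
  ring

/-- The source is symmetric, so `S = τ - τᵀ` obeys `∂S/∂t + u·∇S = G S + S Gᵀ - S / We` with `G =
∇u`. Thus `|S|²` satisfies a Grönwall inequality and starts from zero. -/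
theorem IsSolution.stress_transpose (hD : IsOpen D) (hDb : IsBounded D)
    (hreg : IsRegular T D u p τ) (hsol : IsSolution T D Re We ε u p τ)
    (h0 : ∀ x ∈ D, (τ 0 x).transpose = τ 0 x) :
    ∀ t ∈ Ico 0 T, ∀ x ∈ closure D, (τ t x).transpose = τ t x := by
  intro t ht x hx
  have hbT : (t + T) / 2 < T := by linarith [ht.2]
  have htb : t < (t + T) / 2 := by linarith [ht.2]
  set b := (t + T) / 2 with hb
  -- The velocity gradient need not be bounded up to `T`; it is bounded on `(0, b]` because it
  -- extends continuously down to time 0.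
  choose C hC using fun i j => (hreg.grad_u_cont i j).exists_bound (K := Icc 0 b) hDb
    isCompact_Icc fun s hs => ⟨hs.1, hs.2.trans_lt hbT⟩
  have hM : ∀ s ∈ Ioo 0 b, ∀ x ∈ D, ∀ i j, |grad u s x i j| ≤ ∑ i, ∑ j, |C i j| := by
    intro s hs x hx i j
    calc |grad u s x i j| ≤ C i j := hC i j s (Ioo_subset_Icc_self hs)
          ⟨hs.1, hs.2.trans hbT⟩ x hx
      _ ≤ |C i j| := le_abs_self _
      _ ≤ ∑ j, |C i j| := Finset.single_le_sum (f := fun j => |C i j|)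
          (fun j _ => abs_nonneg _) (Finset.mem_univ j)
      _ ≤ _ := Finset.single_le_sum (f := fun i => ∑ j, |C i j|)
          (fun i _ => Finset.sum_nonneg fun j _ => abs_nonneg _) (Finset.mem_univ i)
  set M := ∑ i, ∑ j, |C i j|
  have hF : ∀ k : Fin d × Fin d, RegularField b D (entry τ k.1 k.2) :=
    fun k => (hreg.stress k).mono hbT.le
  have hU : ∀ t ∈ Ico 0 b, ∀ x ∈ closure D,
      (fun k : Fin d × Fin d => entry τ k.1 k.2 t x) ∈ univ := fun _ _ _ _ => mem_univ _
  have hΦ := (contDiff_normSq_sub_transpose (d := d)).contDiffOn (s := univ)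
  -- The terms `G S` and `S Gᵀ` contribute `2 M d` each. The last term carries an absolute value as
  -- no sign of `We` is assumed here.
  have hzero := (RegularField.comp_contDiffOn hF isOpen_univ hΦ hU).eq_zero_of_transport_le hD hDb
    ((hsol.solenoidalFlow hreg).mono hbT.le) (C := 4 * (M * d) + 2 * |1 / We|) ?_ ?_ ?_ t
    ⟨ht.1, htb⟩ x hx
  · exact (sub_eq_zero.1 (normSq_eq_zero hzero)).symm
  · intro x hx
    have : τ 0 x - (τ 0 x).transpose = 0 := by rw [h0 x hx, sub_self]
    calc _ = normSq (τ 0 x - (τ 0 x).transpose) := rfl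
      _ = 0 := by rw [this]; simp [normSq]
  · exact fun _ _ _ _ => normSq_nonneg _
  · intro s hs x hx
    rw [transport_comp_contDiffOn hF isOpen_univ hΦ hU hs hx, fderiv_normSq_sub_transpose]
    have hR : matOf (fun k : Fin d × Fin d => transport u (entry τ k.1 k.2) s x)
        = _ := hsol.stress s ⟨hs.1, hs.2.trans hbT⟩ x hx
    rw [hR]
    change ∑ i, ∑ j, 2 * ((τ s x - (τ s x).transpose) i j * _)
      ≤ _ * normSq (τ s x - (τ s x).transpose)
    set G := grad u s x
    set S := τ s x - (τ s x).transpose with hS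
    have hRS : ∀ R : Mat d, R = G * τ s x + τ s x * G.transpose - (1 / We) • τ s x
        + (ε / We) • (G + G.transpose) →
        R - R.transpose = G * S + S * G.transpose - (1 / We) • S := by
      rintro R rfl
      simp only [hS, Matrix.transpose_add, Matrix.transpose_sub, Matrix.transpose_mul,
        Matrix.transpose_smul, Matrix.transpose_transpose, mul_sub, sub_mul, smul_sub, smul_add]
      abel
    rw [hRS _ rfl]
    have h1 := sum_mul_mul_le (hM s hs x hx) S
    have h2 : ∑ i, ∑ j, S i j * (S * G.transpose) i j ≤ M * d * normSq S := by
      have h := sum_mul_mul_le (hM s hs x hx) S.transpose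
      rw [normSq_transpose, Finset.sum_comm] at h
      refine le_of_eq_of_le (Finset.sum_congr rfl fun i _ => Finset.sum_congr rfl fun j _ => ?_) h
      rw [Matrix.transpose_apply, ← Matrix.transpose_apply (G * S.transpose), Matrix.transpose_mul,
        Matrix.transpose_transpose]
    have h3 : ∑ i, ∑ j, 2 * (S i j * (G * S + S * G.transpose - (1 / We) • S) i j)
        = 2 * ∑ i, ∑ j, S i j * (G * S) i j + 2 * ∑ i, ∑ j, S i j * (S * G.transpose) i j
          - 2 * (1 / We) * normSq S := by
      simp only [normSq, Finset.mul_sum, ← Finset.sum_add_distrib, ← Finset.sum_sub_distrib]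
      refine Finset.sum_congr rfl fun i _ => Finset.sum_congr rfl fun j _ => ?_
      simp only [Matrix.sub_apply, Matrix.add_apply, Matrix.smul_apply, smul_eq_mul]
      ring
    rw [h3]
    have h4 : -(1 / We) * normSq S ≤ |1 / We| * normSq S :=
      mul_le_mul_of_nonneg_right (neg_le_abs _) (normSq_nonneg S)
    linarith

/-! ### Positivity of the conformation tensor -/

/-- The source `(ε / We) (G + Gᵀ)`, once rescaled, is what the identity in `A` adds to `G A + A Gᵀ`.
-/
theorem conformation_rate (hWe : 0 < We) (hε : 0 < ε) (G M : Mat d) :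
    (We / ε) • (G * M + M * G.transpose - (1 / We) • M + (ε / We) • (G + G.transpose))
      = G * ((We / ε) • M + 1) + ((We / ε) • M + 1) * G.transpose
        - (1 / We) • ((We / ε) • M + 1 - 1) := by
  have h : We / ε * (ε / We) = 1 := by field_simp
  rw [add_sub_cancel_right, mul_add, add_mul, mul_one, one_mul, smul_add, smul_sub, smul_add,
    smul_smul (We / ε) (ε / We), h, one_smul, Matrix.mul_smul, Matrix.smul_mul, smul_comm (We / ε)]
  abel

/-- By cyclicity both stretching terms have trace `tr G = 0`, so only relaxation changes `ln det A`.
-/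
theorem trace_inv_mul_rate {A G : Mat d} (hA : A.det ≠ 0) (hG : G.trace = 0) (w : ℝ) :
    (A⁻¹ * (G * A + A * G.transpose - w • (A - 1))).trace = w * (A⁻¹.trace - d) := by
  have hu : IsUnit A.det := isUnit_iff_ne_zero.2 hA
  rw [mul_sub, mul_add, Matrix.trace_sub, Matrix.trace_add, Matrix.trace_mul_comm A⁻¹ (G * A),
    mul_assoc G, Matrix.mul_nonsing_inv A hu, ← mul_assoc A⁻¹ A, Matrix.nonsing_inv_mul A hu,
    mul_one, one_mul, Matrix.trace_transpose, hG, Matrix.mul_smul, Matrix.trace_smul, mul_sub,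
    Matrix.nonsing_inv_mul A hu, mul_one, Matrix.trace_sub, Matrix.trace_one, Fintype.card_fin,
    smul_eq_mul]
  ring

theorem trace_rate {A G : Mat d} (hA : A.transpose = A) (w : ℝ) :
    (G * A + A * G.transpose - w • (A - 1)).trace = 2 * (G * A).trace - w * (A.trace - d) := by
  have h : (A * G.transpose).trace = (G * A).trace := by
    rw [← Matrix.trace_transpose, Matrix.transpose_mul, Matrix.transpose_transpose, hA]
  rw [Matrix.trace_sub, Matrix.trace_add, h, Matrix.trace_smul, Matrix.trace_sub, Matrix.trace_one,
    Fintype.card_fin, smul_eq_mul]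
  ring

theorem IsSolution.trace_grad (hsol : IsSolution T D Re We ε u p τ) {t : ℝ} (ht : t ∈ Ioo 0 T)
    {x : Space d} (hx : x ∈ D) : (grad u t x).trace = 0 :=
  hsol.incompressible t ht x hx

theorem IsSolution.conformation_transport (hWe : 0 < We) (hε : 0 < ε)
    (hsol : IsSolution T D Re We ε u p τ) {t : ℝ} (ht : t ∈ Ioo 0 T) {x : Space d} (hx : x ∈ D) :
    (We / ε) • matOf (fun k : Fin d × Fin d => transport u (entry τ k.1 k.2) t x)
      = grad u t x * conformation We ε τ t x + conformation We ε τ t x * (grad u t x).transpose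
        - (1 / We) • (conformation We ε τ t x - 1) := by
  have hR : matOf (fun k : Fin d × Fin d => transport u (entry τ k.1 k.2) t x) = _ :=
    hsol.stress t ht x hx
  rw [hR, conformation_rate hWe hε]
  rfl

/-- As long as the conformation tensor is positive definite, its determinant decays at most
exponentially. -/
theorem IsSolution.le_log_det (hD : IsOpen D) (hDb : IsBounded D) (hWe : 0 < We) (hε : 0 < ε)
    (hreg : IsRegular T D u p τ) (hsol : IsSolution T D Re We ε u p τ) {b : ℝ} (hb : b ≤ T)
    (hpos : ∀ t ∈ Ico 0 b, ∀ x ∈ closure D, (conformation We ε τ t x).PosDef) {m : ℝ}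
    (h0 : ∀ x ∈ D, m ≤ Real.log (conformation We ε τ 0 x).det) :
    ∀ t ∈ Ico 0 b, ∀ x ∈ closure D, m - d / We * t ≤ Real.log (conformation We ε τ t x).det := by
  have hF : ∀ k : Fin d × Fin d, RegularField b D (entry τ k.1 k.2) :=
    fun k => (hreg.stress k).mono hb
  have hU : ∀ t ∈ Ico 0 b, ∀ x ∈ closure D, (fun k : Fin d × Fin d => entry τ k.1 k.2 t x)
      ∈ {y : Fin d × Fin d → ℝ | 0 < ((We / ε) • matOf y + 1).det} :=
    fun t ht x hx => (hpos t ht x hx).det_pos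
  have hΦ := contDiffOn_log_det_affine (d := d) (We / ε)
  refine (RegularField.comp_contDiffOn hF (isOpen_det_affine_pos _) hΦ hU).le_of_le_transport hD hDb
    ((hsol.solenoidalFlow hreg).mono hb) h0 fun t ht x hx => ?_
  have hA := hpos t (Ioo_subset_Ico_self ht) x (subset_closure hx)
  have ht' : t ∈ Ioo 0 T := ⟨ht.1, ht.2.trans_le hb⟩
  rw [transport_comp_contDiffOn hF (isOpen_det_affine_pos _) hΦ hU ht hx,
    fderiv_log_det_affine _ hA.det_pos, hsol.conformation_transport hWe hε ht' hx]
  change _ ≤ ((conformation We ε τ t x)⁻¹ * _).trace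
  rw [trace_inv_mul_rate hA.det_pos.ne' (hsol.trace_grad ht' hx)]
  -- The rate is `(tr A⁻¹ - d) / We`; dropping the nonnegative `tr A⁻¹` leaves `-d / We`.
  have h1 := hA.inv.posSemidef.trace_nonneg
  have h2 : 0 ≤ 1 / We * (conformation We ε τ t x)⁻¹.trace := by positivity
  rw [mul_sub, div_eq_mul_one_div (d : ℝ) We]
  linarith

/-- Normalising the witness confines failures of positivity to a compact set of directions. -/
theorem exists_norm_eq_one_of_not_posDef {A : Mat d} (hA : A.transpose = A) (h : ¬ A.PosDef) :
    ∃ ξ : Fin d → ℝ, ‖ξ‖ = 1 ∧ ξ ⬝ᵥ A.mulVec ξ ≤ 0 := by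
  have hH : A.IsHermitian := by simpa [Matrix.IsHermitian] using hA
  have : ∃ ξ : Fin d → ℝ, ξ ≠ 0 ∧ ξ ⬝ᵥ A.mulVec ξ ≤ 0 := by
    by_contra! hcon
    exact h (Matrix.PosDef.of_dotProduct_mulVec_pos hH fun ξ hξ => by simpa using hcon ξ hξ)
  obtain ⟨ξ, hξ, hle⟩ := this
  refine ⟨‖ξ‖⁻¹ • ξ, by simp [norm_smul, hξ], ?_⟩
  rw [Matrix.mulVec_smul, dotProduct_smul, smul_dotProduct, smul_eq_mul, smul_eq_mul, ← mul_assoc]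
  exact mul_nonpos_of_nonneg_of_nonpos (by positivity) hle

/-- The conformation tensor remains symmetric positive definite. -/
theorem IsSolution.conformation_posDef (hD : IsOpen D) (hDb : IsBounded D) (hWe : 0 < We)
    (hε : 0 < ε) (hreg : IsRegular T D u p τ) (hsol : IsSolution T D Re We ε u p τ)
    (hA : ∀ x ∈ closure D, (conformation We ε τ 0 x).PosDef) :
    ∀ t ∈ Ico 0 T, ∀ x ∈ closure D, (conformation We ε τ t x).PosDef := by
  have hc : We / ε ≠ 0 := (div_pos hWe hε).ne'
  have hsymm : ∀ t ∈ Ico 0 T, ∀ x ∈ closure D,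
      (conformation We ε τ t x).transpose = conformation We ε τ t x := by
    intro t ht x hx
    have h0 : ∀ x ∈ D, (τ 0 x).transpose = τ 0 x := fun x hx => by
      have h := (hA x (subset_closure hx)).isHermitian
      rw [Matrix.IsHermitian, Matrix.conjTranspose_eq_transpose_of_trivial, conformation,
        Matrix.transpose_add, Matrix.transpose_smul, Matrix.transpose_one] at h
      exact smul_right_injective _ hc (add_right_cancel h)
    rw [conformation, Matrix.transpose_add, Matrix.transpose_smul, Matrix.transpose_one,
      hsol.stress_transpose hD hDb hreg h0 t ht x hx]
  have hcont := hreg.conformation_cont (We := We) (ε := ε)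
  by_contra! hbad
  obtain ⟨t₁, ht₁, x₁, hx₁, hbad⟩ := hbad
  have hIcc : Icc 0 t₁ ⊆ Ico 0 T := fun s hs => ⟨hs.1, hs.2.trans_lt ht₁.2⟩
  let q : ℝ × Space d × (Fin d → ℝ) → ℝ := fun z => z.2.2 ⬝ᵥ
    (conformation We ε τ z.1 z.2.1).mulVec z.2.2
  let B : Set (ℝ × Space d × (Fin d → ℝ)) := Icc 0 t₁ ×ˢ closure D ×ˢ Metric.sphere 0 1
  have hB : IsCompact B := isCompact_Icc.prod (hDb.isCompact_closure.prod (isCompact_sphere _ _))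
  have hq : ContinuousOn q B := by
    have h1 : ContinuousOn (fun z : ℝ × Space d × (Fin d → ℝ) =>
        conformation We ε τ z.1 z.2.1) B :=
      hcont.comp (f := fun z : ℝ × Space d × (Fin d → ℝ) => (z.1, z.2.1)) (by fun_prop)
        fun z hz => ⟨hIcc hz.1, hz.2.1⟩
    have h2 : Continuous fun w : Mat d × (Fin d → ℝ) => w.2 ⬝ᵥ w.1.mulVec w.2 :=
      continuous_snd.dotProduct (continuous_fst.matrix_mulVec continuous_snd)
    exact h2.comp_continuousOn (h1.prodMk (by fun_prop : ContinuousOn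
      (fun z : ℝ × Space d × (Fin d → ℝ) => z.2.2) B))
  -- The failures form a compact set of times, points and directions, so there is a first failure
  -- time `t₀`.
  have hK : IsCompact (B ∩ q ⁻¹' Iic 0) :=
    hB.of_isClosed_subset (hq.preimage_isClosed_of_isClosed hB.isClosed isClosed_Iic)
      inter_subset_left
  have hmem : ∀ t ∈ Icc 0 t₁, ∀ x ∈ closure D, ¬ (conformation We ε τ t x).PosDef →
      ∃ ξ, (t, x, ξ) ∈ B ∩ q ⁻¹' Iic 0 := fun t ht x hx hn => by
    obtain ⟨ξ, hξ, hle⟩ := exists_norm_eq_one_of_not_posDef (hsymm t (hIcc ht) x hx) hn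
    exact ⟨ξ, ⟨ht, hx, by simpa using hξ⟩, hle⟩
  obtain ⟨ξ₁, hξ₁⟩ := hmem t₁ (right_mem_Icc.2 ht₁.1) x₁ hx₁ hbad
  obtain ⟨_, ⟨⟨t₀, x₀, ξ₀⟩, ⟨⟨ht₀, hx₀, hξ₀⟩, hq₀⟩, rfl⟩, hleast⟩ :=
    (hK.image continuous_fst).exists_isLeast ⟨_, mem_image_of_mem _ hξ₁⟩
  simp only at ht₀ hx₀ hξ₀ hleast
  have hξ₀' : ξ₀ ≠ 0 := by
    rintro rfl
    simp at hξ₀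
  have ht₀pos : 0 < t₀ := by
    refine lt_of_le_of_ne ht₀.1 fun h => ?_
    subst h
    have := (hA x₀ hx₀).dotProduct_mulVec_pos hξ₀'
    rw [star_trivial] at this
    exact this.not_ge hq₀
  have ht₀T : t₀ < T := (hIcc ht₀).2
  have hpos : ∀ t ∈ Ico 0 t₀, ∀ x ∈ closure D, (conformation We ε τ t x).PosDef := by
    intro t ht x hx
    by_contra hn
    obtain ⟨ξ, hξ⟩ := hmem t ⟨ht.1, ht.2.le.trans ht₀.2⟩ x hx hn
    exact absurd (hleast (mem_image_of_mem _ hξ)) (not_le.2 ht.2)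
  have h0T : (0 : ℝ) ∈ Ico 0 T := ⟨le_rfl, ht₀pos.trans ht₀T⟩
  have hdet0 : ContinuousOn (fun x => Real.log (conformation We ε τ 0 x).det) (closure D) := by
    refine ContinuousOn.log ?_ fun x hx => (hA x hx).det_pos.ne'
    exact continuous_id.matrix_det.comp_continuousOn
      (hcont.comp (f := fun x => ((0 : ℝ), x)) (by fun_prop) fun x hx => ⟨h0T, hx⟩)
  obtain ⟨C, hC⟩ := hDb.isCompact_closure.exists_bound_of_continuousOn hdet0
  have hlog := hsol.le_log_det hD hDb hWe hε hreg ht₀T.le hpos (m := -C)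
    fun x hx => (abs_le.1 (hC x (subset_closure hx))).1
  have hlim : Tendsto (fun s => conformation We ε τ s x₀) (𝓝[<] t₀)
      (𝓝 (conformation We ε τ t₀ x₀)) := by
    have h1 : ContinuousWithinAt (fun s => conformation We ε τ s x₀) (Ico 0 T) t₀ :=
      (hcont (t₀, x₀) ⟨hIcc ht₀, hx₀⟩).comp (f := fun s => (s, x₀)) (by fun_prop)
        fun s hs => ⟨hs, hx₀⟩
    refine h1.tendsto.mono_left (nhdsWithin_le_of_mem ?_)
    filter_upwards [Ioo_mem_nhdsLT ht₀pos] with s hs using ⟨hs.1.le, hs.2.trans ht₀T⟩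
  have hev : ∀ᶠ s in 𝓝[<] t₀, s ∈ Ico 0 t₀ := by
    filter_upwards [Ioo_mem_nhdsLT ht₀pos] with s hs using ⟨hs.1.le, hs.2⟩
  -- The lower bound for `ln det A` before `t₀` is uniform, so it survives the limit.
  have hdet : 0 < (conformation We ε τ t₀ x₀).det := by
    refine (Real.exp_pos (-C - d / We * t₀)).trans_le
      (ge_of_tendsto ((continuous_id.matrix_det.tendsto _).comp hlim) ?_)
    filter_upwards [hev] with s hs
    rw [Function.comp, id, ← Real.le_log_iff_exp_le (hpos s hs x₀ hx₀).det_pos]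
    refine le_trans ?_ (hlog s hs x₀ hx₀)
    have : 0 ≤ (d : ℝ) / We := by positivity
    nlinarith [hs.2]
  have hpsd : (conformation We ε τ t₀ x₀).PosSemidef := by
    refine Matrix.PosSemidef.of_dotProduct_mulVec_nonneg ?_ fun ξ => ?_
    · rw [Matrix.IsHermitian, Matrix.conjTranspose_eq_transpose_of_trivial]
      exact hsymm t₀ (hIcc ht₀) x₀ hx₀
    · have h2 : Continuous fun M : Mat d => star ξ ⬝ᵥ M.mulVec ξ :=
        continuous_const.dotProduct (continuous_id.matrix_mulVec continuous_const)
      refine ge_of_tendsto ((h2.tendsto _).comp hlim) ?_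
      filter_upwards [hev] with s hs
      exact (hpos s hs x₀ hx₀).posSemidef.dotProduct_mulVec_nonneg ξ
  -- A semidefinite matrix annihilates every vector on which its quadratic form vanishes.
  have hz : (conformation We ε τ t₀ x₀).mulVec ξ₀ = 0 := by
    refine (hpsd.dotProduct_mulVec_zero_iff ξ₀).1 (le_antisymm ?_
      (hpsd.dotProduct_mulVec_nonneg ξ₀))
    rw [star_trivial]
    exact hq₀
  exact hdet.ne' (Matrix.exists_mulVec_eq_zero_iff.1 ⟨ξ₀, hξ₀', hz⟩)

end Conformation

/-! ### Energy balances and a priori bounds -/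

section Energy

variable {D : Set (Space d)} {T Re We ε : ℝ} {u : ℝ → Space d → Space d} {p : ℝ → Space d → ℝ}
  {τ : ℝ → Space d → Mat d}

/-! ### Balance of kinetic energy -/

theorem norm_sq_eq_sum_comp (t : ℝ) (x : Space d) : ‖u t x‖ ^ 2 = ∑ i, comp u i t x ^ 2 := by
  simp [EuclideanSpace.norm_sq_eq, comp]

theorem IsRegular.regularField_norm_sq (hreg : IsRegular T D u p τ) :
    RegularField T D fun t x => ‖u t x‖ ^ 2 := by
  have hΦ : ContDiffOn ℝ 1 (fun y : Fin d → ℝ => ∑ i, y i ^ 2) univ :=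
    ContDiff.contDiffOn (by fun_prop)
  have h := RegularField.comp_contDiffOn hreg.velocity isOpen_univ hΦ fun _ _ _ _ => mem_univ _
  simpa only [norm_sq_eq_sum_comp] using h

theorem IsRegular.transport_norm_sq (hreg : IsRegular T D u p τ) {t : ℝ} (ht : t ∈ Ioo 0 T)
    {x : Space d} (hx : x ∈ D) :
    transport u (fun t x => ‖u t x‖ ^ 2) t x = 2 * ∑ i, u t x i * transport u (comp u i) t x := by
  have hΦ : ∀ y ∈ (univ : Set (Fin d → ℝ)), HasFDerivAt (fun y : Fin d → ℝ => ∑ i, y i ^ 2)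
      (∑ i, (2 * y i) • ContinuousLinearMap.proj (R := ℝ) (φ := fun _ : Fin d => ℝ) i) y := by
    intro y _
    refine HasFDerivAt.fun_sum fun i _ => ?_
    simpa using (ContinuousLinearMap.proj (R := ℝ) (φ := fun _ : Fin d => ℝ) i).hasFDerivAt.pow 2
  simp only [norm_sq_eq_sum_comp]
  rw [transport_comp_fields hreg.velocity hΦ (fun _ _ _ _ => mem_univ _) ht hx]
  simp only [_root_.sum_apply, _root_.smul_apply, ContinuousLinearMap.proj_apply, smul_eq_mul,
    Finset.mul_sum, comp, mul_assoc]

theorem SolenoidalFlow.integrableOn_sum_velocity_mul_dx (hD : IsOpen D) (hDb : IsBounded D)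
    (hu : SolenoidalFlow T D u) {g : Fin d → Fin d → ℝ → Space d → ℝ}
    (hg : ∀ i j, SpaceC1 T D (g i j)) {t : ℝ} (ht : t ∈ Ioo 0 T) :
    IntegrableOn (fun x => ∑ i, ∑ j, u t x i * dx j (g i j) t x) D :=
  (ExtendsTo.sum _ fun i => ExtendsTo.sum _ fun j =>
    (hu.space i).ext.mul ((hg i j).ext_dx j)).integrableOn_slice hD hDb ht

theorem SolenoidalFlow.integral_sum_velocity_mul_dx (hD : IsOpen D) (hDb : IsBounded D)
    (hu : SolenoidalFlow T D u) {g : Fin d → Fin d → ℝ → Space d → ℝ}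
    (hg : ∀ i j, SpaceC1 T D (g i j)) {t : ℝ} (ht : t ∈ Ioo 0 T) :
    ∫ x in D, ∑ i, ∑ j, u t x i * dx j (g i j) t x
      = -∫ x in D, ∑ i, ∑ j, dx j (comp u i) t x * g i j t x := by
  have h1 : ∀ i j, IntegrableOn (fun x => u t x i * dx j (g i j) t x) D := fun i j =>
    ((hu.space i).ext.mul ((hg i j).ext_dx j)).integrableOn_slice hD hDb ht
  have h2 : ∀ i j, IntegrableOn (fun x => dx j (comp u i) t x * g i j t x) D := fun i j =>
    (((hu.space i).ext_dx j).mul (hg i j).ext).integrableOn_slice hD hDb ht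
  rw [integral_finsetSum _ fun i _ => integrable_finsetSum _ fun j _ => h1 i j,
    integral_finsetSum _ fun i _ => integrable_finsetSum _ fun j _ => h2 i j,
    ← Finset.sum_neg_distrib]
  refine Finset.sum_congr rfl fun i _ => ?_
  rw [integral_finsetSum _ fun j _ => h1 i j, integral_finsetSum _ fun j _ => h2 i j,
    ← Finset.sum_neg_distrib]
  exact Finset.sum_congr rfl fun j _ => hu.integral_velocity_mul_dx hD hDb ht (hg i j) i j

/-- The rate of change of the kinetic energy. -/
theorem IsSolution.integral_transport_norm_sq (hD : IsOpen D) (hDb : IsBounded D)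
    (hreg : IsRegular T D u p τ) (hsol : IsSolution T D Re We ε u p τ) {t : ℝ}
    (ht : t ∈ Ioo 0 T) :
    Re / 2 * ∫ x in D, transport u (fun t x => ‖u t x‖ ^ 2) t x
      = -(1 - ε) * (∫ x in D, normSq (grad u t x))
        - ∫ x in D, ∑ i, ∑ j, grad u t x i j * τ t x i j := by
  have hu := hsol.solenoidalFlow hreg
  have hG := hreg.grad_u_space
  have hp : IntegrableOn (fun x => ∑ i, u t x i * dx i p t x) D :=
    (ExtendsTo.sum _ fun i =>
      (hu.space i).ext.mul (hreg.p_space.ext_dx i)).integrableOn_slice hD hDb ht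
  have hpt : ∀ x ∈ D, Re / 2 * transport u (fun t x => ‖u t x‖ ^ 2) t x
      = (1 - ε) * (∑ i, ∑ j, u t x i * dx j (dx j (comp u i)) t x) - (∑ i, u t x i * dx i p t x)
        + ∑ i, ∑ j, u t x i * dx j (entry τ i j) t x := by
    intro x hx
    rw [hreg.transport_norm_sq ht hx]
    calc Re / 2 * (2 * ∑ i, u t x i * transport u (comp u i) t x)
        = ∑ i, u t x i * (Re * transport u (comp u i) t x) := by
          rw [← mul_assoc, Finset.mul_sum]
          exact Finset.sum_congr rfl fun i _ => by ring
      _ = _ := by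
          simp only [hsol.momentum t ht x hx, Finset.mul_sum, ← Finset.sum_add_distrib,
            ← Finset.sum_sub_distrib]
          refine Finset.sum_congr rfl fun i _ => ?_
          rw [mul_add, mul_sub, Finset.mul_sum, Finset.mul_sum]
          simp only [mul_left_comm]
  have h1 := (hu.integrableOn_sum_velocity_mul_dx hD hDb hG ht).const_mul (1 - ε)
  have h2 : IntegrableOn (fun x => (1 - ε) * (∑ i, ∑ j, u t x i * dx j (dx j (comp u i)) t x)
      - ∑ i, u t x i * dx i p t x) D := h1.sub hp
  -- The viscous and stress terms are integrated by parts; the pressure term is the convection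
  -- integral of `p`, hence zero.
  rw [← integral_const_mul, setIntegral_congr_fun hD.measurableSet hpt, integral_add h2
    (hu.integrableOn_sum_velocity_mul_dx hD hDb hreg.τ_space ht), integral_sub h1 hp,
    integral_const_mul, hu.integral_sum_velocity_mul_dx hD hDb hG ht,
    hu.integral_sum_velocity_mul_dx hD hDb hreg.τ_space ht,
    hu.integral_convection hD hDb ht hreg.p_space]
  simp only [normSq, grad, Matrix.of_apply, entry, pow_two]
  ring

/-! ### Balance of entropy -/

/-- Cramer's rule makes `A⁻¹` a rational function of the entries. -/
theorem continuousOn_relaxDensity {A : ℝ × Space d → Mat d} {s : Set (ℝ × Space d)}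
    (hA : ContinuousOn A s) (hdet : ∀ z ∈ s, (A z).det ≠ 0) :
    ContinuousOn (fun z => relaxDensity (A z)) s := by
  have h : ContinuousOn (fun z => (A z).trace - 2 * d + ((A z).det)⁻¹ * (A z).adjugate.trace) s :=
    ((continuous_id.matrix_trace.comp_continuousOn hA).sub continuousOn_const).add
      (((continuous_id.matrix_det.comp_continuousOn hA).inv₀ hdet).mul
        (continuous_id.matrix_adjugate.matrix_trace.comp_continuousOn hA))
  refine h.congr fun z hz => ?_
  rw [relaxDensity_eq (hdet z hz), Matrix.inv_def, Matrix.trace_smul, Ring.inverse_eq_inv',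
    smul_eq_mul]

theorem IsRegular.relaxDensity_cont (hreg : IsRegular T D u p τ)
    (hpos : ∀ t ∈ Ico 0 T, ∀ x ∈ closure D, (conformation We ε τ t x).PosDef) :
    ContinuousOn (fun z : ℝ × Space d => relaxDensity (conformation We ε τ z.1 z.2))
      (Ico 0 T ×ˢ closure D) :=
  continuousOn_relaxDensity hreg.conformation_cont fun z hz =>
    (hpos z.1 hz.1 z.2 hz.2).det_pos.ne'

theorem IsRegular.regularField_entropyDensity (hreg : IsRegular T D u p τ)
    (hpos : ∀ t ∈ Ico 0 T, ∀ x ∈ closure D, (conformation We ε τ t x).PosDef) :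
    RegularField T D fun t x => entropyDensity (conformation We ε τ t x) :=
  RegularField.comp_contDiffOn hreg.stress (isOpen_det_affine_pos (We / ε))
    (contDiffOn_entropyDensity_affine _) fun t ht x hx => (hpos t ht x hx).det_pos

theorem IsRegular.integrableOn_entropyDensity (hD : IsOpen D) (hDb : IsBounded D)
    (hreg : IsRegular T D u p τ)
    (hpos : ∀ t ∈ Ico 0 T, ∀ x ∈ closure D, (conformation We ε τ t x).PosDef) {t : ℝ}
    (ht : t ∈ Ico 0 T) : IntegrableOn (fun x => entropyDensity (conformation We ε τ t x)) D :=
  (extendsTo_of_continuousOn (f := fun t x => entropyDensity (conformation We ε τ t x))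
    (hreg.regularField_entropyDensity hpos).cont).integrableOn_slice hD hDb ht

theorem IsRegular.integrableOn_relaxDensity (hD : IsOpen D) (hDb : IsBounded D)
    (hreg : IsRegular T D u p τ)
    (hpos : ∀ t ∈ Ico 0 T, ∀ x ∈ closure D, (conformation We ε τ t x).PosDef) {t : ℝ}
    (ht : t ∈ Ico 0 T) : IntegrableOn (fun x => relaxDensity (conformation We ε τ t x)) D :=
  (extendsTo_of_continuousOn (f := fun t x => relaxDensity (conformation We ε τ t x))
    (hreg.relaxDensity_cont hpos)).integrableOn_slice hD hDb ht

/-- The law of `A` is contracted with `I - A⁻¹`. As `tr G = 0`, the identity in `A` drops out of `tr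
(G A)`, leaving `(We / ε) G : τ`. -/
theorem IsSolution.transport_entropyDensity (hWe : 0 < We) (hε : 0 < ε)
    (hreg : IsRegular T D u p τ) (hsol : IsSolution T D Re We ε u p τ)
    (hpos : ∀ t ∈ Ico 0 T, ∀ x ∈ closure D, (conformation We ε τ t x).PosDef) {t : ℝ}
    (ht : t ∈ Ioo 0 T) {x : Space d} (hx : x ∈ D) :
    transport u (fun t x => entropyDensity (conformation We ε τ t x)) t x
      = 2 * (We / ε) * (∑ i, ∑ j, grad u t x i j * τ t x i j)
        - 1 / We * relaxDensity (conformation We ε τ t x) := by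
  have hA := hpos t (Ioo_subset_Ico_self ht) x (subset_closure hx)
  have hAT : (conformation We ε τ t x).transpose = conformation We ε τ t x := by
    simpa [Matrix.IsHermitian] using hA.isHermitian
  have h := transport_comp_contDiffOn (u := u) hreg.stress (isOpen_det_affine_pos (We / ε))
    (contDiffOn_entropyDensity_affine _) (fun t ht x hx => (hpos t ht x hx).det_pos) ht hx
  rw [fderiv_entropyDensity_affine _ hA.det_pos, hsol.conformation_transport hWe hε ht hx] at h
  refine h.trans ?_
  change (_ : Mat d).trace - ((conformation We ε τ t x)⁻¹ * _).trace = _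
  rw [trace_inv_mul_rate hA.det_pos.ne' (hsol.trace_grad ht hx), trace_rate hAT,
    relaxDensity_eq hA.det_pos.ne']
  have h2 : (grad u t x * conformation We ε τ t x).trace
      = We / ε * ∑ i, ∑ j, grad u t x i j * τ t x i j := by
    -- The trace pairs `G i j` with the `(j, i)` entry; symmetry turns this into the pairing of
    -- equal indices.
    nth_rewrite 1 [← hAT]
    rw [conformation, Matrix.transpose_add, Matrix.transpose_one, mul_add, mul_one,
      Matrix.trace_add, hsol.trace_grad ht hx, add_zero, Matrix.transpose_smul, Matrix.mul_smul,
      Matrix.trace_smul, smul_eq_mul]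
    simp [Matrix.trace, Matrix.mul_apply]
  rw [h2]
  ring

/-- The rate of change of the entropy. -/
theorem IsSolution.integral_transport_entropyDensity (hD : IsOpen D) (hDb : IsBounded D)
    (hWe : 0 < We) (hε : 0 < ε)
    (hreg : IsRegular T D u p τ) (hsol : IsSolution T D Re We ε u p τ)
    (hpos : ∀ t ∈ Ico 0 T, ∀ x ∈ closure D, (conformation We ε τ t x).PosDef) {t : ℝ}
    (ht : t ∈ Ioo 0 T) :
    ε / (2 * We) * (∫ x in D,
        transport u (fun t x => entropyDensity (conformation We ε τ t x)) t x)
      = (∫ x in D, ∑ i, ∑ j, grad u t x i j * τ t x i j)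
        - ε / (2 * We ^ 2) * ∫ x in D, relaxDensity (conformation We ε τ t x) := by
  have h1 : IntegrableOn (fun x => ∑ i, ∑ j, grad u t x i j * τ t x i j) D :=
    (ExtendsTo.sum _ fun i => ExtendsTo.sum _ fun j => ((hreg.u_space i).ext_dx j).mul
      (hreg.τ_space i j).ext).integrableOn_slice hD hDb ht
  have h2 := hreg.integrableOn_relaxDensity hD hDb hpos (Ioo_subset_Ico_self ht)
  rw [setIntegral_congr_fun hD.measurableSet fun x hx =>
    hsol.transport_entropyDensity hWe hε hreg hpos ht hx,
    integral_sub (h1.const_mul _) (h2.const_mul _), integral_const_mul, integral_const_mul]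
  field_simp

/-! ### The free energy -/

/-- The stress power enters the two balances with opposite signs and equal weight, so it cancels. -/
theorem IsSolution.hasDerivAt_freeEnergy (hD : IsOpen D) (hDb : IsBounded D)
    (hWe : 0 < We) (hε : 0 < ε)
    (hreg : IsRegular T D u p τ) (hsol : IsSolution T D Re We ε u p τ)
    (hpos : ∀ t ∈ Ico 0 T, ∀ x ∈ closure D, (conformation We ε τ t x).PosDef) {t : ℝ}
    (ht : t ∈ Ioo 0 T) :
    HasDerivAt (freeEnergy D Re We ε u τ) (-dissipation D We ε u τ t) t := by
  have hu := hsol.solenoidalFlow hreg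
  have h := ((hreg.regularField_norm_sq.hasDerivAt_integral hD hDb hu ht).const_mul (Re / 2)).add
    (((hreg.regularField_entropyDensity hpos).hasDerivAt_integral hD hDb hu ht).const_mul
      (ε / (2 * We)))
  refine h.congr_deriv ?_
  rw [hsol.integral_transport_norm_sq hD hDb hreg ht,
    hsol.integral_transport_entropyDensity hD hDb hWe hε hreg hpos ht, dissipation]
  ring

theorem IsRegular.continuousOn_freeEnergy (hD : IsOpen D) (hDb : IsBounded D)
    (hreg : IsRegular T D u p τ)
    (hpos : ∀ t ∈ Ico 0 T, ∀ x ∈ closure D, (conformation We ε τ t x).PosDef) :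
    ContinuousOn (freeEnergy D Re We ε u τ) (Ico 0 T) :=
  ((continuousOn_setIntegral hD hDb hreg.regularField_norm_sq.cont).const_mul (Re / 2)).add
    ((continuousOn_setIntegral hD hDb (hreg.regularField_entropyDensity hpos).cont).const_mul
      (ε / (2 * We)))

theorem IsRegular.extendsTo_normSq_grad (hreg : IsRegular T D u p τ) :
    ExtendsTo (Ioo 0 T ×ˢ D) (Ico 0 T ×ˢ closure D) fun t x => normSq (grad u t x) := by
  have h := ExtendsTo.sum Finset.univ fun i => ExtendsTo.sum Finset.univ fun j =>
    (hreg.grad_u_cont i j).mul (hreg.grad_u_cont i j)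
  simp only [← pow_two] at h
  exact h

theorem IsRegular.intervalIntegrable_normSq_grad (hD : IsOpen D) (hDb : IsBounded D)
    (hreg : IsRegular T D u p τ) {t : ℝ} (ht : t ∈ Ico 0 T) :
    IntervalIntegrable (fun s => ∫ x in D, normSq (grad u s x)) volume 0 t := by
  obtain ⟨g, hg, hgf⟩ := hreg.extendsTo_normSq_grad
  have hc := continuousOn_setIntegral hD hDb (f := fun t x => g (t, x)) hg
  have hI : IntervalIntegrable (fun s => ∫ x in D, g (s, x)) volume 0 t := by
    refine (hc.mono ?_).intervalIntegrable
    rw [uIcc_of_le ht.1]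
    exact fun s hs => ⟨hs.1, hs.2.trans_lt ht.2⟩
  -- Nothing ties `grad u` at time 0 to the continuous extension, so the two are compared on the
  -- open interval only.
  refine hI.congr_uIoo fun s hs => ?_
  rw [uIoo_of_le ht.1] at hs
  exact setIntegral_congr_fun hD.measurableSet fun x hx => hgf s x ⟨⟨hs.1, hs.2.trans ht.2⟩, hx⟩

theorem IsRegular.intervalIntegrable_relaxDensity (hD : IsOpen D) (hDb : IsBounded D)
    (hreg : IsRegular T D u p τ)
    (hpos : ∀ t ∈ Ico 0 T, ∀ x ∈ closure D, (conformation We ε τ t x).PosDef) {t : ℝ}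
    (ht : t ∈ Ico 0 T) :
    IntervalIntegrable (fun s => ∫ x in D, relaxDensity (conformation We ε τ s x)) volume 0 t := by
  refine ((continuousOn_setIntegral hD hDb
    (f := fun t x => relaxDensity (conformation We ε τ t x))
    (hreg.relaxDensity_cont hpos)).mono ?_).intervalIntegrable
  rw [uIcc_of_le ht.1]
  exact fun s hs => ⟨hs.1, hs.2.trans_lt ht.2⟩

theorem IsRegular.intervalIntegrable_dissipation (hD : IsOpen D) (hDb : IsBounded D)
    (hreg : IsRegular T D u p τ)
    (hpos : ∀ t ∈ Ico 0 T, ∀ x ∈ closure D, (conformation We ε τ t x).PosDef) {t : ℝ}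
    (ht : t ∈ Ico 0 T) : IntervalIntegrable (dissipation D We ε u τ) volume 0 t :=
  ((hreg.intervalIntegrable_normSq_grad hD hDb ht).const_mul (1 - ε)).add
    ((hreg.intervalIntegrable_relaxDensity hD hDb hpos ht).const_mul (ε / (2 * We ^ 2)))

/-- Continuity at time 0 suffices at the left end, where no derivative is available. -/
theorem IsSolution.freeEnergy_add_integral_dissipation (hD : IsOpen D) (hDb : IsBounded D)
    (hWe : 0 < We) (hε : 0 < ε)
    (hreg : IsRegular T D u p τ) (hsol : IsSolution T D Re We ε u p τ)
    (hpos : ∀ t ∈ Ico 0 T, ∀ x ∈ closure D, (conformation We ε τ t x).PosDef) {t : ℝ}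
    (ht : t ∈ Ico 0 T) :
    freeEnergy D Re We ε u τ t + (∫ s in 0..t, dissipation D We ε u τ s)
      = freeEnergy D Re We ε u τ 0 := by
  have h := intervalIntegral.integral_eq_sub_of_hasDerivAt_of_le ht.1
    ((hreg.continuousOn_freeEnergy hD hDb hpos (Re := Re)).mono fun s hs =>
      ⟨hs.1, hs.2.trans_lt ht.2⟩)
    (fun s hs => hsol.hasDerivAt_freeEnergy hD hDb hWe hε hreg hpos ⟨hs.1, hs.2.trans ht.2⟩)
    (hreg.intervalIntegrable_dissipation hD hDb hpos ht).neg
  rw [intervalIntegral.integral_neg] at h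
  linarith

/-! ### A priori bounds -/

theorem mul_integral_normSq_grad_le_dissipation (hD : IsOpen D) {t : ℝ}
    (hpos : ∀ x ∈ closure D, (conformation We ε τ t x).PosDef) (hε : 0 < ε) :
    (1 - ε) * ∫ x in D, normSq (grad u t x) ≤ dissipation D We ε u τ t := by
  have h : 0 ≤ ∫ x in D, relaxDensity (conformation We ε τ t x) :=
    setIntegral_nonneg hD.measurableSet fun x hx => relaxDensity_nonneg (hpos x (subset_closure hx))
  have h2 : 0 ≤ ε / (2 * We ^ 2) := by positivity
  exact le_add_of_nonneg_right (mul_nonneg h2 h)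

theorem IsSolution.freeEnergy_add_le (hD : IsOpen D) (hDb : IsBounded D)
    (hWe : 0 < We) (hε : 0 < ε)
    (hreg : IsRegular T D u p τ) (hsol : IsSolution T D Re We ε u p τ)
    (hpos : ∀ t ∈ Ico 0 T, ∀ x ∈ closure D, (conformation We ε τ t x).PosDef) {t : ℝ}
    (ht : t ∈ Ico 0 T) :
    freeEnergy D Re We ε u τ t + (1 - ε) * (∫ s in 0..t, ∫ x in D, normSq (grad u s x))
      ≤ freeEnergy D Re We ε u τ 0 := by
  rw [← hsol.freeEnergy_add_integral_dissipation hD hDb hWe hε hreg hpos ht,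
    ← intervalIntegral.integral_const_mul]
  gcongr
  exact intervalIntegral.integral_mono_on ht.1
    ((hreg.intervalIntegrable_normSq_grad hD hDb ht).const_mul _)
    (hreg.intervalIntegrable_dissipation hD hDb hpos ht) fun s hs =>
      mul_integral_normSq_grad_le_dissipation hD (hpos s ⟨hs.1, hs.2.trans_lt ht.2⟩) hε

theorem normSq_smul (c : ℝ) (M : Mat d) : normSq (c • M) = c ^ 2 * normSq M := by
  simp [normSq, Finset.mul_sum, mul_pow]

theorem sqrt_normSq_stress_le (hWe : 0 < We) (hε : 0 < ε) {t : ℝ} {x : Space d}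
    (hA : (conformation We ε τ t x).PosDef) :
    √(normSq (τ t x)) ≤ ε / We * (2 * entropyDensity (conformation We ε τ t x) + d) := by
  have h : τ t x = (ε / We) • (conformation We ε τ t x - 1) := by
    rw [conformation, add_sub_cancel_right, smul_smul, div_mul_div_cancel₀ hWe.ne',
      div_self hε.ne', one_smul]
  have hc : 0 ≤ ε / We := by positivity
  rw [h, normSq_smul, Real.sqrt_mul (sq_nonneg _), Real.sqrt_sq hc]
  exact mul_le_mul_of_nonneg_left (sqrt_normSq_sub_one_le hA) hc

theorem IsRegular.integrableOn_sqrt_normSq_stress (hD : IsOpen D) (hDb : IsBounded D)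
    (hreg : IsRegular T D u p τ) {t : ℝ} (ht : t ∈ Ico 0 T) :
    IntegrableOn (fun x => √(normSq (τ t x))) D := by
  have hc : Continuous fun M : Mat d => √(normSq M) := by
    simp only [normSq]
    fun_prop
  exact (extendsTo_of_continuousOn (f := fun t x => √(normSq (τ t x)))
    (hc.comp_continuousOn hreg.τ_cont)).integrableOn_slice hD hDb ht

/-- Here `2 ε / We = 4 · ε / (2 We)`, so the entropy part is bounded by four times the free energy
after adding the nonnegative kinetic part. -/
theorem IsRegular.integral_sqrt_normSq_stress_le (hD : IsOpen D) (hDb : IsBounded D)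
    (hRe : 0 < Re) (hWe : 0 < We) (hε : 0 < ε) (hreg : IsRegular T D u p τ)
    (hpos : ∀ t ∈ Ico 0 T, ∀ x ∈ closure D, (conformation We ε τ t x).PosDef) {t : ℝ}
    (ht : t ∈ Ico 0 T) :
    ∫ x in D, √(normSq (τ t x))
      ≤ 4 * freeEnergy D Re We ε u τ t + ε * d / We * volume.real D := by
  have hE : IntegrableOn (fun x => entropyDensity (conformation We ε τ t x)) D :=
    hreg.integrableOn_entropyDensity hD hDb hpos ht
  have hconst : IntegrableOn (fun _ : Space d => (d : ℝ)) D :=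
    integrableOn_const hDb.measure_lt_top.ne
  have h := setIntegral_mono_on (hreg.integrableOn_sqrt_normSq_stress hD hDb ht)
    (((hE.const_mul 2).add hconst).const_mul (ε / We)) hD.measurableSet fun x hx =>
      sqrt_normSq_stress_le hWe hε (hpos t ht x (subset_closure hx))
  simp only [Pi.add_apply] at h
  rw [integral_const_mul, integral_add (hE.const_mul 2) hconst, integral_const_mul,
    setIntegral_const, smul_eq_mul] at h
  have hK : 0 ≤ ∫ x in D, ‖u t x‖ ^ 2 := integral_nonneg fun x => sq_nonneg _
  have hRK : 0 ≤ Re * ∫ x in D, ‖u t x‖ ^ 2 := mul_nonneg hRe.le hK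
  refine h.trans ?_
  rw [freeEnergy]
  set I := ∫ x in D, entropyDensity (conformation We ε τ t x)
  have h1 : ε / We * (2 * I + volume.real D * d)
      = 4 * (ε / (2 * We) * I) + ε * d / We * volume.real D := by
    field_simp
    ring
  rw [h1]
  linarith

end Energy

end OldroydB
end

/-! ### The main theorem -/

theorem mainTheorem1 (d : ℕ) (D : Set (OldroydB.Space d)) (hDo : IsOpen D)
    (hDb : Bornology.IsBounded D) (T Re We ε : ℝ) (hT : 0 < T) (hRe : 0 < Re) (hWe : 0 < We)
    (hε0 : 0 < ε) (hε1 : ε < 1) (u : ℝ → OldroydB.Space d → OldroydB.Space d)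
    (p : ℝ → OldroydB.Space d → ℝ) (τ : ℝ → OldroydB.Space d → OldroydB.Mat d)
    (hreg : OldroydB.IsRegular T D u p τ) (hsol : OldroydB.IsSolution T D Re We ε u p τ)
    (hA : ∀ x ∈ closure D, (OldroydB.conformation We ε τ 0 x).PosDef) :
    -- `A` stays symmetric positive definite, and the entropy density is nonnegative
    (∀ t ∈ Ico 0 T, ∀ x ∈ closure D, (OldroydB.conformation We ε τ t x).PosDef ∧
      0 ≤ OldroydB.entropyDensity (OldroydB.conformation We ε τ t x)) ∧
    -- all the integrals over `D` converge
    (∀ t ∈ Ico 0 T, IntegrableOn (fun x => ‖u t x‖ ^ 2) D ∧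
      IntegrableOn (fun x => OldroydB.entropyDensity (OldroydB.conformation We ε τ t x)) D) ∧
    (∀ t ∈ Ioo 0 T, IntegrableOn (fun x => OldroydB.normSq (OldroydB.grad u t x)) D ∧
      IntegrableOn (fun x => OldroydB.relaxDensity (OldroydB.conformation We ε τ t x)) D) ∧
    -- the dissipation identity, in differential and in integrated form
    (∀ t ∈ Ioo 0 T, ∃ F' : ℝ, HasDerivAt (OldroydB.freeEnergy D Re We ε u τ) F' t ∧
      F' + ((1 - ε) * ∫ x in D, OldroydB.normSq (OldroydB.grad u t x))
        + (ε / (2 * We ^ 2)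
          * ∫ x in D, OldroydB.relaxDensity (OldroydB.conformation We ε τ t x)) = 0) ∧
    ContinuousOn (OldroydB.freeEnergy D Re We ε u τ) (Ico 0 T) ∧
    (∀ t ∈ Ico 0 T, IntervalIntegrable (OldroydB.dissipation D We ε u τ) volume 0 t ∧
      OldroydB.freeEnergy D Re We ε u τ t + (∫ s in 0..t, OldroydB.dissipation D We ε u τ s)
        = OldroydB.freeEnergy D Re We ε u τ 0) ∧
    -- the resulting a priori bounds on `u` and `τ`
    (∀ t ∈ Ico 0 T,
      Re / 2 * (∫ x in D, ‖u t x‖ ^ 2) ≤ OldroydB.freeEnergy D Re We ε u τ 0) ∧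
    (∀ t ∈ Ico 0 T,
      IntervalIntegrable (fun s => ∫ x in D, OldroydB.normSq (OldroydB.grad u s x)) volume 0 t ∧
      (1 - ε) * (∫ s in 0..t, ∫ x in D, OldroydB.normSq (OldroydB.grad u s x))
        ≤ OldroydB.freeEnergy D Re We ε u τ 0) ∧
    (∀ t ∈ Ico 0 T, IntegrableOn (fun x => √(OldroydB.normSq (τ t x))) D ∧
      (∫ x in D, √(OldroydB.normSq (τ t x)))
        ≤ 4 * OldroydB.freeEnergy D Re We ε u τ 0 + ε * d / We * volume.real D) := by
  have hpos := hsol.conformation_posDef hDo hDb hWe hε0 hreg hA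
  have hent : ∀ t ∈ Ico 0 T, 0 ≤ ε / (2 * We)
      * ∫ x in D, OldroydB.entropyDensity (OldroydB.conformation We ε τ t x) := fun t ht =>
    mul_nonneg (by positivity) (setIntegral_nonneg hDo.measurableSet fun x hx =>
      OldroydB.entropyDensity_nonneg (hpos t ht x (subset_closure hx)))
  have hkin : ∀ t, 0 ≤ Re / 2 * ∫ x in D, ‖u t x‖ ^ 2 := fun t =>
    mul_nonneg (by positivity) (integral_nonneg fun x => sq_nonneg _)
  have hgrad : ∀ t ∈ Ico 0 T,
      0 ≤ (1 - ε) * ∫ s in 0..t, ∫ x in D, OldroydB.normSq (OldroydB.grad u s x) := fun t ht =>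
    mul_nonneg (by linarith) (intervalIntegral.integral_nonneg ht.1 fun s _ =>
      integral_nonneg fun x => OldroydB.normSq_nonneg _)
  have hF := fun t (ht : t ∈ Ico 0 T) => hsol.freeEnergy_add_le hDo hDb hWe hε0 hreg hpos ht
  have hFdef : ∀ t, OldroydB.freeEnergy D Re We ε u τ t = Re / 2 * (∫ x in D, ‖u t x‖ ^ 2)
      + ε / (2 * We) * (∫ x in D, OldroydB.entropyDensity (OldroydB.conformation We ε τ t x)) :=
    fun t => rfl
  refine ⟨fun t ht x hx => ⟨hpos t ht x hx, OldroydB.entropyDensity_nonneg (hpos t ht x hx)⟩,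
    fun t ht => ⟨(OldroydB.extendsTo_of_continuousOn (f := fun t x => ‖u t x‖ ^ 2)
      hreg.regularField_norm_sq.cont).integrableOn_slice hDo hDb ht,
      hreg.integrableOn_entropyDensity hDo hDb hpos ht⟩,
    fun t ht => ⟨(hreg.extendsTo_normSq_grad.mono subset_rfl
      (prod_mono Ioo_subset_Ico_self subset_rfl)).integrableOn_slice hDo hDb ht,
      hreg.integrableOn_relaxDensity hDo hDb hpos (Ioo_subset_Ico_self ht)⟩,
    fun t ht => ⟨_, hsol.hasDerivAt_freeEnergy hDo hDb hWe hε0 hreg hpos ht, ?_⟩,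
    hreg.continuousOn_freeEnergy hDo hDb hpos,
    fun t ht => ⟨hreg.intervalIntegrable_dissipation hDo hDb hpos ht,
      hsol.freeEnergy_add_integral_dissipation hDo hDb hWe hε0 hreg hpos ht⟩,
    fun t ht => ?_,
    fun t ht => ⟨hreg.intervalIntegrable_normSq_grad hDo hDb ht, ?_⟩,
    fun t ht => ⟨hreg.integrableOn_sqrt_normSq_stress hDo hDb ht, ?_⟩⟩
  · rw [OldroydB.dissipation]
    ring
  -- Each remaining bound drops nonnegative terms from `F(t) + (1 - ε) ∫∫ |∇u|² ≤ F(0)`.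
  · linarith [hF t ht, hgrad t ht, hent t ht, hFdef t]
  · linarith [hF t ht, hkin t, hent t ht, hFdef t]
  · linarith [hF t ht, hgrad t ht,
      hreg.integral_sqrt_normSq_stress_le hDo hDb hRe hWe hε0 hpos ht]
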